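/- Let $A\in\mathbb{R}^{n\times n}$, $C\in\mathbb{R}^{p\times n}$, $Q_w\in\mathbb{R}^{n\times n}$, $S_{wv}\in\mathbb{R}^{n\times p}$ and $R_v\in\mathbb{R}^{p\times p}$ with $R_v\succ 0$ (symmetric positive definite), and let $$\begin{bmatrix} Q_w & S_{wv}\\ S_{wv}^\top & R_v\end{bmatrix}=\begin{bmatrix}\tilde B\\ \tilde D\end{bmatrix}\begin{bmatrix}\tilde B^\top & \tilde D^\top\end{bmatrix}$$ be a full rank factorization, where $\tilde B\in\mathbb{R}^{n\times r}$, $\tilde D\in\mathbb{R}^{p\times r}$ and $\begin{bmatrix}\tilde B\\ \tilde D\end{bmatrix}$ has rank $r$. For $P\succeq 0$ (symmetric positive semidefinite) put $R(P)=CPC^\top+R_v$ and $K(P)=(APC^\top+S_{wv})R(P)^{-1}$. Consider the discrete algebraic Riccati equation (DARE) $$P=APA^\top+Q_w-(APC^\top+S_{wv})(CPC^\top+R_v)^{-1}(APC^\top+S_{wv})^\top,$$ and, for $\hat P_0\succeq 0$, the error covariances $$\hat P_{k+1}=A\hat P_kA^\top+Q_w-K(\hat P_k)R(\hat P_k)K(\hat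 P_k)^\top,\qquad k\ge 0.$$ A real square matrix is called stable if its spectral radius is less than $1$; a solution $P$ of the DARE is stabilizing if $A-K(P)C$ is stable; $(A,C)$ is detectable if $A-LC$ is stable for some real matrix $L$; $(A,B)$ is stabilizable if $A-BG$ is stable for some real matrix $G$. Then the following are equivalent: (i) the DARE has exactly one solution $\hat P\succeq 0$, and this solution is stabilizing; (ii) there is a matrix $\hat P$ such that, for every $\hat P_0\succeq 0$, $\hat P_k\to\hat P$ exponentially fast, that is, there are $c\ge 0$ and $\rho\in[0,1)$ (which may depend on $\hat P_0$) with $\|\hat P_k-\hat P\|\le c\rho^k$ for all $k\ge 0$; (iii) $(A,C)$ is detectable, and $(A-FC,\tilde B-F\tilde D)$ is stabilizable for every $F\in\mathbb{R}^{n\times p}$. Moreover, when these hold, the limit $\hat P$ in (ii) is the unique positive semidefinite solution of the DARE in (i). -/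

import Mathlib

open Matrix

namespace KalmanFilter

/-- Schur stability of a real square matrix: the spectral radius, taken over its complex
eigenvalues, is less than one. -/
def IsSchurStable {n : ℕ} (A : Matrix (Fin n) (Fin n) ℝ) : Prop :=
  spectralRadius ℂ (A.map (algebraMap ℝ ℂ)) < 1

/-- `(A, B)` is stabilizable: some state feedback makes the closed loop Schur stable. -/
def IsStabilizable {n m : ℕ} (A : Matrix (Fin n) (Fin n) ℝ) (B : Matrix (Fin n) (Fin m) ℝ) :
    Prop :=
  ∃ K : Matrix (Fin m) (Fin n) ℝ, IsSchurStable (A - B * K)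

/-- `(A, C)` is detectable: some output injection makes the error dynamics Schur stable. -/
def IsDetectable {n p : ℕ} (A : Matrix (Fin n) (Fin n) ℝ) (C : Matrix (Fin p) (Fin n) ℝ) :
    Prop :=
  ∃ L : Matrix (Fin n) (Fin p) ℝ, IsSchurStable (A - L * C)

section Riccati

variable {n p : ℕ}

/-- The innovation covariance `C P Cᵀ + R`. -/
def innovationCov (C : Matrix (Fin p) (Fin n) ℝ) (R : Matrix (Fin p) (Fin p) ℝ)
    (P : Matrix (Fin n) (Fin n) ℝ) : Matrix (Fin p) (Fin p) ℝ :=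
  C * P * Cᵀ + R

/-- The filter gain `(A P Cᵀ + S) (C P Cᵀ + R)⁻¹`. -/
noncomputable def gain (A : Matrix (Fin n) (Fin n) ℝ) (C : Matrix (Fin p) (Fin n) ℝ)
    (S : Matrix (Fin n) (Fin p) ℝ) (R : Matrix (Fin p) (Fin p) ℝ)
    (P : Matrix (Fin n) (Fin n) ℝ) : Matrix (Fin n) (Fin p) ℝ :=
  (A * P * Cᵀ + S) * (innovationCov C R P)⁻¹

/-- The error covariances of the time-varying filter started at `P₀`:
`P_{k+1} = A P_k Aᵀ + Q - K_k R_k K_kᵀ`, where `R_k` is the innovation covariance and `K_k`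
the gain at `P_k`. -/
noncomputable def errorCov (A : Matrix (Fin n) (Fin n) ℝ) (C : Matrix (Fin p) (Fin n) ℝ)
    (Q : Matrix (Fin n) (Fin n) ℝ) (S : Matrix (Fin n) (Fin p) ℝ)
    (R : Matrix (Fin p) (Fin p) ℝ) (P₀ : Matrix (Fin n) (Fin n) ℝ) :
    ℕ → Matrix (Fin n) (Fin n) ℝ
  | 0 => P₀
  | k + 1 =>
    let P := errorCov A C Q S R P₀ k
    A * P * Aᵀ + Q - gain A C S R P * innovationCov C R P * (gain A C S R P)ᵀ

/-- The discrete algebraic Riccati equation of the filter. -/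
def SolvesDARE (A : Matrix (Fin n) (Fin n) ℝ) (C : Matrix (Fin p) (Fin n) ℝ)
    (Q : Matrix (Fin n) (Fin n) ℝ) (S : Matrix (Fin n) (Fin p) ℝ)
    (R : Matrix (Fin p) (Fin p) ℝ) (P : Matrix (Fin n) (Fin n) ℝ) : Prop :=
  P = A * P * Aᵀ + Q - (A * P * Cᵀ + S) * (C * P * Cᵀ + R)⁻¹ * (A * P * Cᵀ + S)ᵀ

/-- `P` is the only positive semidefinite solution of the DARE, and it is stabilizing, that is,
`A - K C` is Schur stable for the gain `K` at `P`. -/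
def IsUniqueStabilizingSolution (A : Matrix (Fin n) (Fin n) ℝ) (C : Matrix (Fin p) (Fin n) ℝ)
    (Q : Matrix (Fin n) (Fin n) ℝ) (S : Matrix (Fin n) (Fin p) ℝ)
    (R : Matrix (Fin p) (Fin p) ℝ) (P : Matrix (Fin n) (Fin n) ℝ) : Prop :=
  P.PosSemidef ∧ SolvesDARE A C Q S R P ∧ IsSchurStable (A - gain A C S R P * C) ∧
    ∀ P' : Matrix (Fin n) (Fin n) ℝ, P'.PosSemidef → SolvesDARE A C Q S R P' → P' = P

open scoped Matrix.Norms.L2Operator in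
/-- A sequence of matrices converges to `P` exponentially fast (in the spectral norm). -/
def ConvergesExponentially (X : ℕ → Matrix (Fin n) (Fin n) ℝ) (P : Matrix (Fin n) (Fin n) ℝ) :
    Prop :=
  ∃ c ρ : ℝ, 0 ≤ c ∧ 0 ≤ ρ ∧ ρ < 1 ∧ ∀ k : ℕ, ‖X k - P‖ ≤ c * ρ ^ k

/-- From every positive semidefinite initial value, the error covariances converge
exponentially fast to `P`. -/
def ErrorCovConvergesTo (A : Matrix (Fin n) (Fin n) ℝ) (C : Matrix (Fin p) (Fin n) ℝ)
    (Q : Matrix (Fin n) (Fin n) ℝ) (S : Matrix (Fin n) (Fin p) ℝ)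
    (R : Matrix (Fin p) (Fin p) ℝ) (P : Matrix (Fin n) (Fin n) ℝ) : Prop :=
  ∀ P₀ : Matrix (Fin n) (Fin n) ℝ, P₀.PosSemidef →
    ConvergesExponentially (errorCov A C Q S R P₀) P

end Riccati

end KalmanFilter

/-! The factorization turns the noise data into `B Bᵀ`, `B Dᵀ`, `D Dᵀ`. Completing the square
(`josephStep_eq`) shows that the Riccati map is the least, over all gains `K`, of the monotone
affine maps `P ↦ (A - K C) P (A - K C)ᵀ + (B - K D)(B - K D)ᵀ`. Hence it is monotone, and any fixed
gain gives an upper bound. The second tool is the exact difference formula `riccati_sub`, whose two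
outer factors are the closed loops at the two arguments.

(iii) ⇒ (i), (ii). The iterates from zero increase and, by a detecting gain, stay below a convergent
series, so they converge to a fixed point. An unstable left mode of the closed loop at a fixed point
would be orthogonal to the noise, against stabilizability, so every positive semidefinite fixed
point is stabilizing. The difference formula then gives uniqueness. From any start the iterates are
squeezed between those from zero and those of the constant limiting gain, and the linearized error
recursion makes the convergence exponential.

(i) or (ii) ⇒ (iii). In both cases the iterates from zero converge to a stabilizing `P`; this is
where (ii) needs its rate. If `P` had an unstable mode, the error from `P + 1` along it would shrink
by factors `(1 + ε_k)⁻¹` with `ε_k` summable, so it could not vanish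
(`isSchurStable_of_convergesExponentially`). Detectability is then immediate. For stabilizability,
the closed loop at a late iterate is already stable, and it differs from the decorrelated system
matrix by a matrix with reachable columns. Such a perturbation can be traded for a state feedback
(`isStabilizable_of_isReachableIn`), and a change of feedback absorbs every output injection `F`. -/

namespace KalmanFilter

open Filter Topology
open scoped Matrix.Norms.L2Operator MatrixOrder

/-! ### Unstable modes in real form, contracting powers, and geometric decay. -/

section Stability

variable {n : ℕ}

/-- If `Mᵀ V = V Λ` with `Λ Λᵀ = μ • 1`, then `N ↦ tr (Vᵀ N V)` is an eigenfunctional of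
`N ↦ M N Mᵀ` for the eigenvalue `μ`. -/
theorem trace_conj_of_mode {M : Matrix (Fin n) (Fin n) ℝ} {V : Matrix (Fin n) (Fin 2) ℝ}
    {Λ : Matrix (Fin 2) (Fin 2) ℝ} {μ : ℝ} (hV : Mᵀ * V = V * Λ) (hΛ : Λ * Λᵀ = μ • 1)
    (N : Matrix (Fin n) (Fin n) ℝ) :
    (Vᵀ * (M * N * Mᵀ) * V).trace = μ * (Vᵀ * N * V).trace := by
  have h1 : Vᵀ * M = Λᵀ * Vᵀ := by
    simpa using congrArg Matrix.transpose hV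
  calc (Vᵀ * (M * N * Mᵀ) * V).trace = ((Vᵀ * M) * N * (Mᵀ * V)).trace := by
        simp only [Matrix.mul_assoc]
    _ = (Λᵀ * (Vᵀ * N * V * Λ)).trace := by rw [h1, hV]; simp only [Matrix.mul_assoc]
    _ = (Vᵀ * N * V * (Λ * Λᵀ)).trace := by rw [Matrix.trace_mul_comm, Matrix.mul_assoc]
    _ = μ * (Vᵀ * N * V).trace := by rw [hΛ]; simp

theorem trace_transpose_mul_self_pos {m k : ℕ} {V : Matrix (Fin m) (Fin k) ℝ} (hV : V ≠ 0) :
    0 < (Vᵀ * V).trace := by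
  have h := (Matrix.posSemidef_conjTranspose_mul_self V).trace_nonneg
  rw [Matrix.conjTranspose_eq_transpose_of_trivial] at h
  refine lt_of_le_of_ne h fun h0 => hV ?_
  rw [← Matrix.trace_conjTranspose_mul_self_eq_zero_iff,
    Matrix.conjTranspose_eq_transpose_of_trivial]
  exact h0.symm

/-- A real matrix with a mode of modulus at least one has no power of norm less than one. -/
theorem one_le_norm_pow_of_mode {M : Matrix (Fin n) (Fin n) ℝ} {V : Matrix (Fin n) (Fin 2) ℝ}
    {Λ : Matrix (Fin 2) (Fin 2) ℝ} {μ : ℝ} (hV0 : V ≠ 0) (hμ : 1 ≤ μ)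
    (hV : Mᵀ * V = V * Λ) (hΛ : Λ * Λᵀ = μ • 1) (q : ℕ) : 1 ≤ ‖M ^ q‖ := by
  by_contra! hlt
  have hpow : ∀ k : ℕ, (Vᵀ * (M ^ k * (M ^ k)ᵀ) * V).trace = μ ^ k * (Vᵀ * V).trace := by
    intro k
    induction k with
    | zero => simp
    | succ k ih =>
      have : M ^ (k + 1) * (M ^ (k + 1))ᵀ = M * (M ^ k * (M ^ k)ᵀ) * Mᵀ := by
        rw [pow_succ']; simp only [Matrix.transpose_mul, Matrix.mul_assoc]
      rw [this, trace_conj_of_mode hV hΛ, ih]; ring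
  -- The powers of `M ^ q` vanish, while `hpow` keeps their trace along `V` at least `tr (Vᵀ V) >
  -- 0`.
  have ht : Tendsto (fun k : ℕ => M ^ (q * k)) atTop (𝓝 0) := by
    simpa only [pow_mul] using tendsto_pow_atTop_nhds_zero_of_norm_lt_one hlt
  have hc : Continuous fun X : Matrix (Fin n) (Fin n) ℝ => (Vᵀ * (X * Xᵀ) * V).trace := by
    fun_prop
  have ht2 := (hc.tendsto 0).comp ht
  have hpos := trace_transpose_mul_self_pos hV0
  have : (Vᵀ * V).trace ≤ (Vᵀ * ((0 : Matrix (Fin n) (Fin n) ℝ) * 0ᵀ) * V).trace := by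
    refine ge_of_tendsto' ht2 fun k => ?_
    simp only [Function.comp, hpow]
    exact le_mul_of_one_le_left hpos.le (one_le_pow₀ hμ)
  simp at this
  linarith

/-- A real matrix that is not Schur stable has a mode of modulus at least one. -/
theorem exists_mode_of_not_isSchurStable {M : Matrix (Fin n) (Fin n) ℝ}
    (hM : ¬ IsSchurStable M) :
    ∃ (V : Matrix (Fin n) (Fin 2) ℝ) (Λ : Matrix (Fin 2) (Fin 2) ℝ) (μ : ℝ),
      V ≠ 0 ∧ 1 ≤ μ ∧ Mᵀ * V = V * Λ ∧ Λ * Λᵀ = μ • 1 := by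
  have hex : ∃ z ∈ spectrum ℂ (M.map (algebraMap ℝ ℂ)), 1 ≤ ‖z‖ := by
    by_contra! h
    apply hM
    rcases Nat.eq_zero_or_pos n with rfl | hn
    · simp [IsSchurStable, spectralRadius, spectrum.of_subsingleton]
    · have : Nonempty (Fin n) := ⟨⟨0, hn⟩⟩
      have := spectrum.spectralRadius_lt_of_forall_lt (M.map (algebraMap ℝ ℂ)) (r := 1)
        (fun z hz => by simpa [← NNReal.coe_lt_coe] using h z hz)
      simpa [IsSchurStable] using this
  obtain ⟨z, hz, hz1⟩ := hex
  rw [spectrum.mem_iff, Matrix.isUnit_iff_isUnit_det, isUnit_iff_ne_zero, not_not,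
    ← Matrix.exists_vecMul_eq_zero_iff] at hz
  obtain ⟨v, hv0, hv⟩ := hz
  have hv' : ∀ j, ∑ i, v i * (M i j : ℂ) = z * v j := by
    intro j
    have := congrFun hv j
    rw [Matrix.vecMul_sub] at this
    simp only [Matrix.algebraMap_eq_diagonal, Pi.sub_apply, Pi.zero_apply,
      Matrix.vecMul_diagonal] at this
    simp only [Matrix.vecMul, dotProduct, Matrix.map_apply] at this
    rw [sub_eq_zero] at this
    simpa [mul_comm] using this.symm
  -- The columns of `V` are the real and imaginary parts of a left eigenvector for `z`. `Λ` is
  -- multiplication by `z` in this basis, so `μ = |z|²`.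
  refine ⟨Matrix.of fun i j => if j = 0 then (v i).re else (v i).im,
    !![z.re, z.im; -z.im, z.re], z.re ^ 2 + z.im ^ 2, ?_, ?_, ?_, ?_⟩
  · intro h
    apply hv0
    funext i
    have h0 := congrFun (congrFun h i) 0
    have h1 := congrFun (congrFun h i) 1
    simp at h0 h1
    exact Complex.ext h0 h1
  · have : ‖z‖ ^ 2 = z.re ^ 2 + z.im ^ 2 := by
      rw [← Complex.normSq_eq_norm_sq, Complex.normSq_apply]; ring
    rw [← this]
    exact one_le_pow₀ hz1
  · ext j k
    have hre := congrArg Complex.re (hv' j)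
    have him := congrArg Complex.im (hv' j)
    simp only [Complex.re_sum, Complex.im_sum, Complex.mul_re, Complex.mul_im, Complex.ofReal_re,
      Complex.ofReal_im, mul_zero, sub_zero, zero_add] at hre him
    fin_cases k
    · simp [Matrix.mul_apply, Fin.sum_univ_two, mul_comm] at hre ⊢
      linarith
    · simp [Matrix.mul_apply, Fin.sum_univ_two, mul_comm] at him ⊢
      linarith
  · ext i j
    fin_cases i <;> fin_cases j <;> simp [Matrix.mul_apply, Fin.sum_univ_two] <;> ring

/-- A real matrix is Schur stable if and only if one of its powers is a contraction. -/
theorem isSchurStable_iff_exists_norm_pow_lt_one {M : Matrix (Fin n) (Fin n) ℝ} :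
    IsSchurStable M ↔ ∃ q : ℕ, 0 < q ∧ ‖M ^ q‖ < 1 := by
  constructor
  · intro h
    set Mc : Matrix (Fin n) (Fin n) ℂ := M.map (algebraMap ℝ ℂ) with hMc
    have ht := spectrum.pow_nnnorm_pow_one_div_tendsto_nhds_spectralRadius Mc
    obtain ⟨m, hm, hm0⟩ := ((ht.eventually_lt_const h).and (eventually_gt_atTop 0)).exists
    have hlt : ‖Mc ^ m‖ < 1 := by
      by_contra! hle
      have : (1 : ENNReal) ≤ ‖Mc ^ m‖₊ := by exact_mod_cast hle
      exact absurd hm (not_lt.mpr (ENNReal.one_le_rpow this (by positivity)))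
    have htc : Tendsto (fun k : ℕ => (Mc ^ m) ^ k) atTop (𝓝 0) :=
      tendsto_pow_atTop_nhds_zero_of_norm_lt_one hlt
    -- Gelfand's formula yields a contracting complex power. Taking real parts carries the decay to
    -- `M` without comparing real and complex norms.
    have hre : Continuous fun X : Matrix (Fin n) (Fin n) ℂ => X.map Complex.re := by fun_prop
    have htr := (hre.tendsto 0).comp htc
    have heq : ∀ k, ((Mc ^ m) ^ k).map Complex.re = M ^ (m * k) := by
      intro k
      have : Mc ^ (m * k) = (M ^ (m * k)).map (algebraMap ℝ ℂ) := by
        exact (map_pow (algebraMap ℝ ℂ).mapMatrix M (m * k)).symm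
      rw [← pow_mul, this]
      ext i j; simp
    have htr' : Tendsto (fun k : ℕ => M ^ (m * k)) atTop (𝓝 0) := by
      convert htr using 2
      · exact (heq _).symm
      · ext i j; simp
    have hn := htr'.norm
    rw [norm_zero] at hn
    obtain ⟨k, hk, hk0⟩ := ((hn.eventually_lt_const one_pos).and (eventually_gt_atTop 0)).exists
    exact ⟨m * k, Nat.mul_pos hm0 hk0, hk⟩
  · rintro ⟨q, -, hq⟩
    by_contra hM
    obtain ⟨V, Λ, μ, hV0, hμ, hV, hΛ⟩ := exists_mode_of_not_isSchurStable hM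
    exact absurd hq (not_lt.mpr (one_le_norm_pow_of_mode hV0 hμ hV hΛ q))

theorem not_isSchurStable_of_mode {M : Matrix (Fin n) (Fin n) ℝ} {V : Matrix (Fin n) (Fin 2) ℝ}
    {Λ : Matrix (Fin 2) (Fin 2) ℝ} {μ : ℝ} (hV0 : V ≠ 0) (hμ : 1 ≤ μ)
    (hV : Mᵀ * V = V * Λ) (hΛ : Λ * Λᵀ = μ • 1) : ¬ IsSchurStable M := by
  rw [isSchurStable_iff_exists_norm_pow_lt_one]
  rintro ⟨q, -, hq⟩
  exact absurd hq (not_lt.mpr (one_le_norm_pow_of_mode hV0 hμ hV hΛ q))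

/-- Schur stability is an open condition. -/
theorem IsSchurStable.eventually_nhds {M : Matrix (Fin n) (Fin n) ℝ} (hM : IsSchurStable M) :
    ∀ᶠ X in 𝓝 M, IsSchurStable X := by
  obtain ⟨q, hq0, hq⟩ := isSchurStable_iff_exists_norm_pow_lt_one.mp hM
  have hc : Continuous fun X : Matrix (Fin n) (Fin n) ℝ => ‖X ^ q‖ := by fun_prop
  filter_upwards [(hc.tendsto M).eventually_lt_const hq] with X hX
  exact isSchurStable_iff_exists_norm_pow_lt_one.mpr ⟨q, hq0, hX⟩

/-- A sequence that asymptotically follows a linear map with a contracting power decays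
geometrically. -/
theorem exists_geometric_bound {E : Type*} [NormedAddCommGroup E] [NormedSpace ℝ E]
    (T : E →L[ℝ] E) {q : ℕ} (hq : 0 < q) (hT : ‖T ^ q‖ < 1) (e : ℕ → E) (ε : ℕ → ℝ)
    (hε : Tendsto ε atTop (𝓝 0)) (he : ∀ k, ‖e (k + 1) - T (e k)‖ ≤ ε k * ‖e k‖) :
    ∃ c ρ : ℝ, 0 ≤ c ∧ 0 ≤ ρ ∧ ρ < 1 ∧ ∀ k, ‖e k‖ ≤ c * ρ ^ k := by
  obtain ⟨a, ha1, haq⟩ : ∃ a : ℝ, 1 < a ∧ a ^ q * ‖T ^ q‖ ≤ 1 := by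
    have hc : Tendsto (fun a : ℝ => a ^ q * ‖T ^ q‖) (𝓝[>] 1) (𝓝 (1 ^ q * ‖T ^ q‖)) :=
      ((by fun_prop : Continuous fun a : ℝ => a ^ q * ‖T ^ q‖).tendsto 1).mono_left
        nhdsWithin_le_nhds
    rw [one_pow, one_mul] at hc
    obtain ⟨a, ha, ha1⟩ := ((hc.eventually_lt_const hT).and self_mem_nhdsWithin).exists
    exact ⟨a, ha1, ha.le⟩
  have ha0 : 0 < a := one_pos.trans ha1
  -- An adapted norm, equivalent to the given one, for which `T` itself contracts by `a⁻¹`: shifting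
  -- the sum replaces the term `‖x‖` by `a ^ q * ‖(T ^ q) x‖`, which is no larger.
  set v : E → ℝ := fun x => ∑ j ∈ Finset.range q, a ^ j * ‖(T ^ j) x‖ with hv
  have hnv : ∀ x, ‖x‖ ≤ v x := by
    intro x
    have := Finset.single_le_sum (f := fun j => a ^ j * ‖(T ^ j) x‖)
      (fun j _ => by positivity) (Finset.mem_range.mpr hq)
    simpa only [pow_zero, one_mul, one_apply_eq_self] using this
  have hvT : ∀ x, v (T x) ≤ a⁻¹ * v x := by
    intro x
    have h1 : a * v (T x) + ‖x‖ = v x + a ^ q * ‖(T ^ q) x‖ := by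
      have := Finset.sum_range_succ (fun j => a ^ j * ‖(T ^ j) x‖) q
      rw [Finset.sum_range_succ'] at this
      simp only [hv]
      rw [← this, Finset.mul_sum]
      congr 1
      · refine Finset.sum_congr rfl fun j _ => ?_
        rw [pow_succ T]
        simp only [mul_apply_eq_comp]
        ring
      · simp
    have h2 : a ^ q * ‖(T ^ q) x‖ ≤ ‖x‖ := by
      calc a ^ q * ‖(T ^ q) x‖ ≤ a ^ q * (‖T ^ q‖ * ‖x‖) := by
            gcongr; exact (T ^ q).le_opNorm x
        _ = (a ^ q * ‖T ^ q‖) * ‖x‖ := by ring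
        _ ≤ 1 * ‖x‖ := by gcongr
        _ = ‖x‖ := one_mul _
    rw [inv_mul_eq_div, le_div_iff₀ ha0]
    linarith
  set b : ℝ := ∑ j ∈ Finset.range q, a ^ j * ‖T ^ j‖ with hb
  have hvb : ∀ x, v x ≤ b * ‖x‖ := by
    intro x
    simp only [hv, hb, Finset.sum_mul]
    refine Finset.sum_le_sum fun j _ => ?_
    rw [mul_assoc]
    gcongr
    exact (T ^ j).le_opNorm x
  have hadd : ∀ x y, v (x + y) ≤ v x + v y := by
    intro x y
    simp only [hv, ← Finset.sum_add_distrib]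
    refine Finset.sum_le_sum fun j _ => ?_
    rw [map_add, ← mul_add]
    gcongr
    exact norm_add_le _ _
  have hb0 : 0 ≤ b := Finset.sum_nonneg fun j _ => by positivity
  obtain ⟨ρ, hρ1, hρ2⟩ := exists_between (inv_lt_one_of_one_lt₀ ha1)
  have hρ0 : 0 < ρ := (inv_pos.mpr ha0).trans hρ1
  -- No sign is assumed for `ε`; a negative value forces `e (k + 1) = T (e k)`.
  have hev : ∀ᶠ k in atTop, a⁻¹ + b * ε k < ρ ∧ 0 ≤ ε k ∨ v (e (k + 1)) ≤ ρ * v (e k) := by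
    have : Tendsto (fun k => a⁻¹ + b * ε k) atTop (𝓝 (a⁻¹ + b * 0)) := by
      exact (hε.const_mul b).const_add _
    rw [mul_zero, add_zero] at this
    filter_upwards [this.eventually_lt_const hρ1] with k hk
    by_cases h0 : 0 ≤ ε k
    · exact Or.inl ⟨hk, h0⟩
    · right
      have h1 := he k
      have h2 : ε k * ‖e k‖ ≤ 0 := mul_nonpos_of_nonpos_of_nonneg (not_le.mp h0).le (norm_nonneg _)
      have h3 : e (k + 1) = T (e k) := by
        rw [← sub_eq_zero, ← norm_le_zero_iff]; linarith
      rw [h3]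
      refine (hvT _).trans ?_
      gcongr
  obtain ⟨k₀, hk₀⟩ := eventually_atTop.mp hev
  have hstep : ∀ k, k₀ ≤ k → v (e (k + 1)) ≤ ρ * v (e k) := by
    intro k hk
    rcases hk₀ k hk with ⟨h1, h2⟩ | h
    · have hve : 0 ≤ v (e k) := (norm_nonneg _).trans (hnv _)
      calc v (e (k + 1)) = v (T (e k) + (e (k + 1) - T (e k))) := by rw [add_sub_cancel]
        _ ≤ v (T (e k)) + v (e (k + 1) - T (e k)) := hadd _ _
        _ ≤ a⁻¹ * v (e k) + b * (ε k * v (e k)) := by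
            gcongr
            · exact hvT _
            · refine (hvb _).trans ?_
              gcongr
              refine (he k).trans ?_
              gcongr
              exact hnv _
        _ = (a⁻¹ + b * ε k) * v (e k) := by ring
        _ ≤ ρ * v (e k) := by gcongr
    · exact h
  have hterm : ∀ j, 0 ≤ v (e j) / ρ ^ j := fun j =>
    div_nonneg ((norm_nonneg _).trans (hnv _)) (by positivity)
  -- The constant dominates every `v (e j) / ρ ^ j` up to `k₀`, where the contraction by `ρ` sets
  -- in.
  refine ⟨∑ j ∈ Finset.range (k₀ + 1), v (e j) / ρ ^ j, ρ,
    Finset.sum_nonneg fun j _ => hterm j, hρ0.le, hρ2, fun k => (hnv _).trans ?_⟩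
  have hsmall : ∀ k ≤ k₀, v (e k) ≤ (∑ j ∈ Finset.range (k₀ + 1), v (e j) / ρ ^ j) * ρ ^ k := by
    intro k hk
    rw [← div_le_iff₀ (by positivity)]
    exact Finset.single_le_sum (f := fun j => v (e j) / ρ ^ j) (fun j _ => hterm j)
      (Finset.mem_range.mpr (Nat.lt_succ_of_le hk))
  rcases le_total k k₀ with hk | hk
  · exact hsmall k hk
  · induction k, hk using Nat.le_induction with
    | base => exact hsmall k₀ le_rfl
    | succ k hk ih =>
      calc v (e (k + 1)) ≤ ρ * v (e k) := hstep k hk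
        _ ≤ ρ * ((∑ j ∈ Finset.range (k₀ + 1), v (e j) / ρ ^ j) * ρ ^ k) := by gcongr
        _ = _ := by ring

/-- The powers of a Schur stable matrix are bounded by a geometric sequence. -/
theorem IsSchurStable.exists_norm_pow_le {M : Matrix (Fin n) (Fin n) ℝ} (hM : IsSchurStable M) :
    ∃ c ρ : ℝ, 0 ≤ c ∧ 0 ≤ ρ ∧ ρ < 1 ∧ ∀ k, ‖M ^ k‖ ≤ c * ρ ^ k := by
  obtain ⟨q, hq0, hq⟩ := isSchurStable_iff_exists_norm_pow_lt_one.mp hM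
  refine exists_geometric_bound (ContinuousLinearMap.mul ℝ (Matrix (Fin n) (Fin n) ℝ) M) hq0 ?_
    (fun k => M ^ k) (fun _ => 0) tendsto_const_nhds fun k => ?_
  · have hpow : ∀ (j : ℕ) X, (ContinuousLinearMap.mul ℝ (Matrix (Fin n) (Fin n) ℝ) M ^ j) X =
        M ^ j * X := by
      intro j X
      induction j with
      | zero => simp
      | succ j ih =>
        rw [pow_succ' (ContinuousLinearMap.mul ℝ _ M), mul_apply_eq_comp, ih,
          ContinuousLinearMap.mul_apply', pow_succ', mul_assoc]
    refine lt_of_le_of_lt (ContinuousLinearMap.opNorm_le_bound _ (norm_nonneg _) fun X => ?_) hq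
    rw [hpow]
    exact norm_mul_le _ _
  · simp [pow_succ']

theorem IsSchurStable.tendsto_pow {M : Matrix (Fin n) (Fin n) ℝ} (hM : IsSchurStable M) :
    Tendsto (fun k : ℕ => M ^ k) atTop (𝓝 0) := by
  obtain ⟨c, ρ, -, hρ0, hρ1, h⟩ := hM.exists_norm_pow_le
  refine squeeze_zero_norm h ?_
  simpa using (tendsto_pow_atTop_nhds_zero_of_lt_one hρ0 hρ1).const_mul c

theorem l2_opNorm_transpose {m k : ℕ} (X : Matrix (Fin m) (Fin k) ℝ) : ‖Xᵀ‖ = ‖X‖ := by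
  rw [← Matrix.conjTranspose_eq_transpose_of_trivial, Matrix.l2_opNorm_conjTranspose]

/-- A perturbation of the recursion `e ↦ M e Mᵀ` with `M` Schur stable decays geometrically. -/
theorem IsSchurStable.exists_geometric_bound_conj {M : Matrix (Fin n) (Fin n) ℝ}
    (hM : IsSchurStable M) (e : ℕ → Matrix (Fin n) (Fin n) ℝ) (ε : ℕ → ℝ)
    (hε : Tendsto ε atTop (𝓝 0)) (he : ∀ k, ‖e (k + 1) - M * e k * Mᵀ‖ ≤ ε k * ‖e k‖) :
    ∃ c ρ : ℝ, 0 ≤ c ∧ 0 ≤ ρ ∧ ρ < 1 ∧ ∀ k, ‖e k‖ ≤ c * ρ ^ k := by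
  obtain ⟨q, hq0, hq⟩ := isSchurStable_iff_exists_norm_pow_lt_one.mp hM
  let T : Matrix (Fin n) (Fin n) ℝ →L[ℝ] Matrix (Fin n) (Fin n) ℝ :=
    (LinearMap.mulLeftRight ℝ (M, Mᵀ)).toContinuousLinearMap
  have hT : ∀ X, T X = M * X * Mᵀ := fun X => by simp [T]
  refine exists_geometric_bound T hq0 ?_ e ε hε fun k => by rw [hT]; exact he k
  have hpow : ∀ (j : ℕ) X, (T ^ j) X = M ^ j * X * (M ^ j)ᵀ := by
    intro j X
    induction j with
    | zero => simp
    | succ j ih =>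
      rw [pow_succ' T, mul_apply_eq_comp, ih, hT, pow_succ']
      simp only [Matrix.transpose_mul, Matrix.mul_assoc]
  have hle : ‖T ^ q‖ ≤ ‖M ^ q‖ * ‖M ^ q‖ := by
    refine ContinuousLinearMap.opNorm_le_bound _ (by positivity) fun X => ?_
    rw [hpow]
    calc ‖M ^ q * X * (M ^ q)ᵀ‖ ≤ ‖M ^ q‖ * ‖X‖ * ‖(M ^ q)ᵀ‖ :=
          (norm_mul_le _ _).trans (by gcongr; exact norm_mul_le _ _)
      _ = ‖M ^ q‖ * ‖M ^ q‖ * ‖X‖ := by rw [l2_opNorm_transpose]; ring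
  refine hle.trans_lt ?_
  nlinarith [norm_nonneg (M ^ q)]

/-- Schur stability is invariant under similarity. -/
theorem IsSchurStable.of_similar {M N T : Matrix (Fin n) (Fin n) ℝ} (hT : IsUnit T)
    (h : T * M = N * T) (hM : IsSchurStable M) : IsSchurStable N := by
  by_contra hN
  obtain ⟨V, Λ, μ, hV0, hμ, hV, hΛ⟩ := exists_mode_of_not_isSchurStable hN
  refine not_isSchurStable_of_mode (V := Tᵀ * V) ?_ hμ ?_ hΛ hM
  · intro h0
    have hd := (Matrix.isUnit_iff_isUnit_det _).mp hT
    apply hV0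
    have : (Tᵀ)⁻¹ * (Tᵀ * V) = V := by
      rw [← Matrix.mul_assoc, Matrix.nonsing_inv_mul _ (by rwa [Matrix.det_transpose]),
        Matrix.one_mul]
    rw [← this, h0, Matrix.mul_zero]
  · rw [← Matrix.mul_assoc, ← Matrix.transpose_mul, h, Matrix.transpose_mul, Matrix.mul_assoc, hV,
      Matrix.mul_assoc]

end Stability

/-! ### Trading a reachable perturbation for a state feedback. -/

section Stabilizability

variable {n m : ℕ} (A : Matrix (Fin n) (Fin n) ℝ) (B : Matrix (Fin n) (Fin m) ℝ)

/-- `IsReachableIn A B k N`: the square matrix `N` has the form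
`B T₀ + A B T₁ + ⋯ + A ^ (k - 1) B Tₖ₋₁`. -/
def IsReachableIn : ℕ → Matrix (Fin n) (Fin n) ℝ → Prop
  | 0, N => N = 0
  | k + 1, N => ∃ (T : Matrix (Fin m) (Fin n) ℝ) (L : Matrix (Fin n) (Fin n) ℝ),
      IsReachableIn k L ∧ N = B * T + A * L

variable {A B}

theorem IsReachableIn.mul_right {k : ℕ} {N : Matrix (Fin n) (Fin n) ℝ}
    (h : IsReachableIn A B k N) (X : Matrix (Fin n) (Fin n) ℝ) :
    IsReachableIn A B k (N * X) := by
  induction k generalizing N with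
  | zero => rw [show N = 0 from h, Matrix.zero_mul]; rfl
  | succ k ih =>
    obtain ⟨T, L, hL, rfl⟩ := h
    exact ⟨T * X, L * X, ih hL, by simp only [Matrix.add_mul, Matrix.mul_assoc]⟩

theorem IsReachableIn.add {k : ℕ} {N N' : Matrix (Fin n) (Fin n) ℝ}
    (h : IsReachableIn A B k N) (h' : IsReachableIn A B k N') :
    IsReachableIn A B k (N + N') := by
  induction k generalizing N N' with
  | zero => rw [show N = 0 from h, show N' = 0 from h', add_zero]; rfl
  | succ k ih =>
    obtain ⟨T, L, hL, rfl⟩ := h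
    obtain ⟨T', L', hL', rfl⟩ := h'
    exact ⟨T + T', L + L', ih hL hL', by simp only [Matrix.mul_add]; abel⟩

theorem IsReachableIn.zero (k : ℕ) : IsReachableIn A B k 0 := by
  induction k with
  | zero => rfl
  | succ k ih => exact ⟨0, 0, ih, by simp⟩

theorem IsReachableIn.input (k : ℕ) (T : Matrix (Fin m) (Fin n) ℝ) :
    IsReachableIn A B (k + 1) (B * T) :=
  ⟨T, 0, IsReachableIn.zero k, by simp⟩

/-- Up to a power of `t⁻¹`, the determinant is the characteristic polynomial of `L` at `t`, which
has finitely many roots. -/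
theorem eventually_isUnit_one_sub_inv_smul (L : Matrix (Fin n) (Fin n) ℝ) :
    ∀ᶠ t : ℝ in 𝓝[≠] 1, IsUnit (1 - t⁻¹ • L) := by
  have hfin : {t : ℝ | L.charpoly.IsRoot t}.Finite :=
    Polynomial.finite_setOfPred_isRoot L.charpoly_monic.ne_zero
  have h1 : ∀ᶠ t : ℝ in 𝓝[≠] 1, ¬ L.charpoly.IsRoot t := by
    have hcl : IsClosed ({t : ℝ | L.charpoly.IsRoot t} \ {1}) := hfin.sdiff.isClosed
    have : ({t : ℝ | L.charpoly.IsRoot t} \ {1})ᶜ ∈ 𝓝[≠] (1 : ℝ) :=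
      mem_nhdsWithin_of_mem_nhds (hcl.isOpen_compl.mem_nhds (by simp))
    filter_upwards [this, self_mem_nhdsWithin] with t ht ht1 hr
    exact ht ⟨hr, ht1⟩
  have h0 : ∀ᶠ t : ℝ in 𝓝[≠] 1, t ≠ 0 :=
    (eventually_ne_nhds one_ne_zero).filter_mono nhdsWithin_le_nhds
  filter_upwards [h0, h1] with t ht0 ht1
  have h2 : (1 : Matrix (Fin n) (Fin n) ℝ) - t⁻¹ • L = t⁻¹ • (Matrix.scalar (Fin n) t - L) := by
    rw [smul_sub]
    congr 1
    ext i j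
    by_cases hij : i = j
    · subst hij; simp [ht0]
    · simp [hij]
  rw [Matrix.isUnit_iff_isUnit_det, h2, Matrix.det_smul, isUnit_iff_ne_zero]
  refine mul_ne_zero (pow_ne_zero _ (inv_ne_zero ht0)) ?_
  rwa [Polynomial.IsRoot, Matrix.eval_charpoly] at ht1

/-- If `A - N` is Schur stable and the columns of `N` are reachable, `(A, B)` is stabilizable. -/
theorem isStabilizable_of_isReachableIn {k : ℕ} {N : Matrix (Fin n) (Fin n) ℝ}
    (hN : IsReachableIn A B k N) (hs : IsSchurStable (A - N)) : IsStabilizable A B := by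
  rcases k with _ | k
  · exact ⟨0, by rwa [Matrix.mul_zero, ← show N = 0 from hN]⟩
  induction k generalizing N with
  | zero =>
    obtain ⟨T, L, hL, rfl⟩ := hN
    exact ⟨T, by rwa [show L = 0 from hL, Matrix.mul_zero, add_zero] at hs⟩
  | succ k ih =>
    obtain ⟨T, L, hL, rfl⟩ := hN
    have hc : ContinuousAt (fun t : ℝ => A * (1 - t⁻¹ • L) - B * T) 1 := by
      have : ContinuousAt (fun t : ℝ => t⁻¹) 1 := continuousAt_inv₀ one_ne_zero
      fun_prop
    have hs' : IsSchurStable (A * (1 - (1 : ℝ)⁻¹ • L) - B * T) := by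
      convert hs using 1
      simp only [inv_one, one_smul, Matrix.mul_sub, Matrix.mul_one]
      abel
    have hev : ∀ᶠ t : ℝ in 𝓝[≠] 1, IsSchurStable (A * (1 - t⁻¹ • L) - B * T) :=
      (hc.eventually hs'.eventually_nhds).filter_mono nhdsWithin_le_nhds
    -- Here `A - N = A (1 - L) - B T`, and `1 - L` may be singular. Stability is open, so `L` may be
    -- scaled slightly to make `U` invertible.
    obtain ⟨t, ht, hu⟩ := (hev.and (eventually_isUnit_one_sub_inv_smul L)).exists
    set U : Matrix (Fin n) (Fin n) ℝ := 1 - t⁻¹ • L with hU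
    have hdet := (Matrix.isUnit_iff_isUnit_det _).mp hu
    -- Conjugating `A U - B T` by `U` gives `U (A - B T U⁻¹)`. There `L` stands without the factor
    -- `A`, so the new perturbation is reachable in one step less.
    refine ih (N := B * (T * U⁻¹) + L * (t⁻¹ • (A - B * (T * U⁻¹))))
      (ht.of_similar hu ?_) ((IsReachableIn.input _ _).add (hL.mul_right _))
    have h1 : A - (B * (T * U⁻¹) + L * (t⁻¹ • (A - B * (T * U⁻¹)))) =
        U * (A - B * (T * U⁻¹)) := by
      rw [hU, Matrix.sub_mul, Matrix.one_mul, Matrix.mul_smul, Matrix.smul_mul]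
      abel
    have h2 : B * (T * U⁻¹) * U = B * T := by
      rw [← Matrix.mul_assoc, Matrix.mul_assoc, Matrix.nonsing_inv_mul _ hdet, Matrix.mul_one]
    rw [h1, Matrix.mul_assoc, Matrix.sub_mul A, h2]

end Stabilizability

/-! ### Algebra and monotonicity of the Riccati map. -/

section RiccatiMap

variable {n p r : ℕ}

theorem conj_posSemidef {l k : ℕ} {X : Matrix (Fin k) (Fin k) ℝ} (hX : X.PosSemidef)
    (N : Matrix (Fin l) (Fin k) ℝ) : (N * X * Nᵀ).PosSemidef := by
  simpa using hX.mul_mul_conjTranspose_same N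

theorem self_mul_transpose_posSemidef {l k : ℕ} (N : Matrix (Fin l) (Fin k) ℝ) :
    (N * Nᵀ).PosSemidef := by
  simpa using Matrix.posSemidef_self_mul_conjTranspose N

theorem conj_le_conj {l k : ℕ} {X Y : Matrix (Fin k) (Fin k) ℝ} (h : X ≤ Y)
    (N : Matrix (Fin l) (Fin k) ℝ) : N * X * Nᵀ ≤ N * Y * Nᵀ := by
  rw [Matrix.le_iff] at h ⊢
  simpa only [Matrix.mul_sub, Matrix.sub_mul] using conj_posSemidef h N

theorem transpose_eq_of_posSemidef {k : ℕ} {X : Matrix (Fin k) (Fin k) ℝ} (h : X.PosSemidef) :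
    Xᵀ = X := by
  simpa using h.isHermitian.eq

/-- The gain of the filter with noise factors `B` and `D`. -/
noncomputable def optGain (A : Matrix (Fin n) (Fin n) ℝ) (B : Matrix (Fin n) (Fin r) ℝ)
    (C : Matrix (Fin p) (Fin n) ℝ) (D : Matrix (Fin p) (Fin r) ℝ)
    (P : Matrix (Fin n) (Fin n) ℝ) : Matrix (Fin n) (Fin p) ℝ :=
  gain A C (B * Dᵀ) (D * Dᵀ) P

/-- The innovation covariance of the filter with noise factors `B` and `D`. -/
noncomputable def optInnovation (C : Matrix (Fin p) (Fin n) ℝ) (D : Matrix (Fin p) (Fin r) ℝ)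
    (P : Matrix (Fin n) (Fin n) ℝ) : Matrix (Fin p) (Fin p) ℝ :=
  innovationCov C (D * Dᵀ) P

/-- One step of the error covariance recursion with the optimal gain. -/
noncomputable def riccati (A : Matrix (Fin n) (Fin n) ℝ) (B : Matrix (Fin n) (Fin r) ℝ)
    (C : Matrix (Fin p) (Fin n) ℝ) (D : Matrix (Fin p) (Fin r) ℝ)
    (P : Matrix (Fin n) (Fin n) ℝ) : Matrix (Fin n) (Fin n) ℝ :=
  A * P * Aᵀ + B * Bᵀ - optGain A B C D P * optInnovation C D P * (optGain A B C D P)ᵀ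

/-- One step of the error covariance recursion with the gain `K`. -/
noncomputable def josephStep (A : Matrix (Fin n) (Fin n) ℝ) (B : Matrix (Fin n) (Fin r) ℝ)
    (C : Matrix (Fin p) (Fin n) ℝ) (D : Matrix (Fin p) (Fin r) ℝ)
    (K : Matrix (Fin n) (Fin p) ℝ) (P : Matrix (Fin n) (Fin n) ℝ) : Matrix (Fin n) (Fin n) ℝ :=
  (A - K * C) * P * (A - K * C)ᵀ + (B - K * D) * (B - K * D)ᵀ

variable {A : Matrix (Fin n) (Fin n) ℝ} {B : Matrix (Fin n) (Fin r) ℝ}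
  {C : Matrix (Fin p) (Fin n) ℝ} {D : Matrix (Fin p) (Fin r) ℝ} {P P₁ P₂ : Matrix (Fin n) (Fin n) ℝ}

theorem josephStep_posSemidef (hP : P.PosSemidef) (K : Matrix (Fin n) (Fin p) ℝ) :
    (josephStep A B C D K P).PosSemidef :=
  (conj_posSemidef hP _).add (self_mul_transpose_posSemidef _)

theorem josephStep_mono (h : P₁ ≤ P₂) (K : Matrix (Fin n) (Fin p) ℝ) :
    josephStep A B C D K P₁ ≤ josephStep A B C D K P₂ := by
  unfold josephStep
  gcongr
  exact conj_le_conj h _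

theorem optInnovation_posDef (hR : (D * Dᵀ).PosDef) (hP : P.PosSemidef) :
    (optInnovation C D P).PosDef :=
  Matrix.PosDef.posSemidef_add (conj_posSemidef hP C) hR

theorem isUnit_det_optInnovation (hR : (D * Dᵀ).PosDef) (hP : P.PosSemidef) :
    IsUnit (optInnovation C D P).det :=
  (Matrix.isUnit_iff_isUnit_det _).mp (optInnovation_posDef hR hP).isUnit

theorem optGain_mul_optInnovation (hR : (D * Dᵀ).PosDef) (hP : P.PosSemidef) :
    optGain A B C D P * optInnovation C D P = A * P * Cᵀ + B * Dᵀ := by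
  have h := isUnit_det_optInnovation (C := C) hR hP
  unfold optInnovation at h ⊢
  rw [optGain, gain, Matrix.mul_assoc, Matrix.nonsing_inv_mul _ h, Matrix.mul_one]

theorem optInnovation_mul_optGain_transpose (hR : (D * Dᵀ).PosDef) (hP : P.PosSemidef) :
    optInnovation C D P * (optGain A B C D P)ᵀ = C * P * Aᵀ + D * Bᵀ := by
  have h := congrArg Matrix.transpose (optGain_mul_optInnovation (A := A) (B := B) (C := C) hR hP)
  have hs := transpose_eq_of_posSemidef (optInnovation_posDef (C := C) hR hP).posSemidef
  rw [Matrix.transpose_mul, hs] at h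
  rw [h]
  simp only [Matrix.transpose_add, Matrix.transpose_mul, Matrix.transpose_transpose,
    transpose_eq_of_posSemidef hP, Matrix.mul_assoc]

/-- Completion of squares: the optimal gain minimizes `josephStep`. -/
theorem josephStep_eq (hR : (D * Dᵀ).PosDef) (hP : P.PosSemidef) (K : Matrix (Fin n) (Fin p) ℝ) :
    josephStep A B C D K P = riccati A B C D P +
      (K - optGain A B C D P) * optInnovation C D P * (K - optGain A B C D P)ᵀ := by
  have h1 := optGain_mul_optInnovation (A := A) (B := B) (C := C) hR hP
  have h2 := optInnovation_mul_optGain_transpose (A := A) (B := B) (C := C) hR hP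
  have hI : optInnovation C D P = C * P * Cᵀ + D * Dᵀ := rfl
  unfold riccati
  set G := optGain A B C D P
  set I := optInnovation C D P
  calc josephStep A B C D K P
      = A * P * Aᵀ + B * Bᵀ - K * (C * P * Aᵀ + D * Bᵀ) - (A * P * Cᵀ + B * Dᵀ) * Kᵀ
          + K * (C * P * Cᵀ + D * Dᵀ) * Kᵀ := by
        simp only [josephStep, Matrix.transpose_sub, Matrix.transpose_mul, Matrix.mul_sub,
          Matrix.sub_mul, Matrix.mul_add, Matrix.add_mul, Matrix.mul_assoc]
        abel
    _ = A * P * Aᵀ + B * Bᵀ - K * (I * Gᵀ) - (G * I) * Kᵀ + K * I * Kᵀ := by rw [h1, h2, hI]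
    _ = _ := by
        simp only [Matrix.transpose_sub, Matrix.mul_sub, Matrix.sub_mul, Matrix.mul_assoc]
        abel

theorem riccati_eq_josephStep (hR : (D * Dᵀ).PosDef) (hP : P.PosSemidef) :
    riccati A B C D P = josephStep A B C D (optGain A B C D P) P := by
  rw [josephStep_eq hR hP]; simp

theorem riccati_posSemidef (hR : (D * Dᵀ).PosDef) (hP : P.PosSemidef) :
    (riccati A B C D P).PosSemidef := by
  rw [riccati_eq_josephStep hR hP]; exact josephStep_posSemidef hP _

theorem riccati_le_josephStep (hR : (D * Dᵀ).PosDef) (hP : P.PosSemidef)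
    (K : Matrix (Fin n) (Fin p) ℝ) : riccati A B C D P ≤ josephStep A B C D K P := by
  rw [josephStep_eq hR hP, Matrix.le_iff, add_sub_cancel_left]
  exact conj_posSemidef (optInnovation_posDef hR hP).posSemidef _

/-- The gain optimal for `P₂` is suboptimal for `P₁`, and for a fixed gain the step is monotone. -/
theorem riccati_mono (hR : (D * Dᵀ).PosDef) (hP₁ : P₁.PosSemidef) (hP₂ : P₂.PosSemidef)
    (h : P₁ ≤ P₂) : riccati A B C D P₁ ≤ riccati A B C D P₂ := by
  rw [riccati_eq_josephStep hR hP₂]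
  exact (riccati_le_josephStep hR hP₁ _).trans (josephStep_mono h _)

theorem optGain_sub (hR : (D * Dᵀ).PosDef) (hP₁ : P₁.PosSemidef) (hP₂ : P₂.PosSemidef) :
    optGain A B C D P₁ - optGain A B C D P₂ =
      (A - optGain A B C D P₂ * C) * (P₁ - P₂) * Cᵀ * (optInnovation C D P₁)⁻¹ := by
  have h1 := optGain_mul_optInnovation (A := A) (B := B) (C := C) hR hP₁
  have h2 := optGain_mul_optInnovation (A := A) (B := B) (C := C) hR hP₂
  have hu := isUnit_det_optInnovation (C := C) hR hP₁
  have hI : optInnovation C D P₁ - optInnovation C D P₂ = C * (P₁ - P₂) * Cᵀ := by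
    simp only [optInnovation, innovationCov, Matrix.mul_sub, Matrix.sub_mul]; abel
  have key : (optGain A B C D P₁ - optGain A B C D P₂) * optInnovation C D P₁ =
      (A - optGain A B C D P₂ * C) * (P₁ - P₂) * Cᵀ := by
    calc (optGain A B C D P₁ - optGain A B C D P₂) * optInnovation C D P₁
        = optGain A B C D P₁ * optInnovation C D P₁ - optGain A B C D P₂ * optInnovation C D P₂
          - optGain A B C D P₂ * (optInnovation C D P₁ - optInnovation C D P₂) := by
          simp only [Matrix.sub_mul, Matrix.mul_sub]; abel
      _ = _ := by
          rw [h1, h2, hI]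
          simp only [Matrix.sub_mul, Matrix.mul_sub, Matrix.mul_assoc]; abel
  rw [← key, Matrix.mul_assoc, Matrix.mul_nonsing_inv _ hu, Matrix.mul_one]

/-- An exact identity with a different closed loop on each side. It serves uniqueness, the
convergence rate and the reachability of the iterates from zero. -/
theorem riccati_sub (hR : (D * Dᵀ).PosDef) (hP₁ : P₁.PosSemidef) (hP₂ : P₂.PosSemidef) :
    riccati A B C D P₁ - riccati A B C D P₂ =
      (A - optGain A B C D P₁ * C) * (P₁ - P₂) * (A - optGain A B C D P₂ * C)ᵀ := by
  have h1 := optGain_mul_optInnovation (A := A) (B := B) (C := C) hR hP₁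
  have h2 := optGain_mul_optInnovation (A := A) (B := B) (C := C) hR hP₂
  have h1' := optInnovation_mul_optGain_transpose (A := A) (B := B) (C := C) hR hP₁
  have h2' := optInnovation_mul_optGain_transpose (A := A) (B := B) (C := C) hR hP₂
  have hI : C * (P₁ - P₂) * Cᵀ = optInnovation C D P₁ - optInnovation C D P₂ := by
    simp only [optInnovation, innovationCov, Matrix.mul_sub, Matrix.sub_mul]; abel
  unfold riccati
  set G₁ := optGain A B C D P₁
  set G₂ := optGain A B C D P₂
  set I₁ := optInnovation C D P₁
  set I₂ := optInnovation C D P₂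
  have ha : C * (P₁ - P₂) * Aᵀ = I₁ * G₁ᵀ - I₂ * G₂ᵀ := by
    rw [h1', h2']; simp only [Matrix.mul_sub, Matrix.sub_mul]; abel
  have hb : A * (P₁ - P₂) * Cᵀ = G₁ * I₁ - G₂ * I₂ := by
    rw [h1, h2]; simp only [Matrix.mul_sub, Matrix.sub_mul]; abel
  symm
  calc (A - G₁ * C) * (P₁ - P₂) * (A - G₂ * C)ᵀ
      = A * (P₁ - P₂) * Aᵀ - G₁ * (C * (P₁ - P₂) * Aᵀ) - (A * (P₁ - P₂) * Cᵀ) * G₂ᵀ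
        + G₁ * (C * (P₁ - P₂) * Cᵀ) * G₂ᵀ := by
        simp only [Matrix.transpose_sub, Matrix.transpose_mul, Matrix.mul_sub,
          Matrix.sub_mul, Matrix.mul_assoc]
        abel
    _ = _ := by
        rw [ha, hb, hI]
        simp only [Matrix.mul_sub, Matrix.sub_mul, Matrix.mul_assoc]
        abel

/-- The increment of the Riccati map, in terms of the closed loop at the smaller argument. -/
theorem riccati_sub' (hR : (D * Dᵀ).PosDef) (hP₁ : P₁.PosSemidef) (hP₂ : P₂.PosSemidef) :
    riccati A B C D P₁ - riccati A B C D P₂ =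
      (A - optGain A B C D P₂ * C) *
        ((P₁ - P₂) - ((P₁ - P₂) * Cᵀ * (optInnovation C D P₁)⁻¹) * optInnovation C D P₁ *
          ((P₁ - P₂) * Cᵀ * (optInnovation C D P₁)⁻¹)ᵀ) * (A - optGain A B C D P₂ * C)ᵀ := by
  have hg := optGain_sub (A := A) (B := B) (C := C) hR hP₁ hP₂
  have hu := isUnit_det_optInnovation (C := C) hR hP₁
  have hs := transpose_eq_of_posSemidef (optInnovation_posDef (C := C) hR hP₁).posSemidef
  have ht : (P₁ - P₂)ᵀ = P₁ - P₂ := by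
    rw [Matrix.transpose_sub, transpose_eq_of_posSemidef hP₁, transpose_eq_of_posSemidef hP₂]
  rw [riccati_sub hR hP₁ hP₂]
  set M := A - optGain A B C D P₂ * C with hM
  -- `optGain_sub` expresses the closed loop at `P₁` through `M`, so both outer factors become `M`.
  have h1 : A - optGain A B C D P₁ * C =
      M - M * (P₁ - P₂) * Cᵀ * (optInnovation C D P₁)⁻¹ * C := by
    rw [← hg, hM, Matrix.sub_mul]; abel
  have h2 : ((P₁ - P₂) * Cᵀ * (optInnovation C D P₁)⁻¹) * optInnovation C D P₁ *
      ((P₁ - P₂) * Cᵀ * (optInnovation C D P₁)⁻¹)ᵀ =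
      (P₁ - P₂) * Cᵀ * (optInnovation C D P₁)⁻¹ * C * (P₁ - P₂) := by
    rw [Matrix.mul_assoc _ (optInnovation C D P₁)⁻¹, Matrix.nonsing_inv_mul _ hu, Matrix.mul_one,
      Matrix.transpose_mul, Matrix.transpose_nonsing_inv, hs, Matrix.transpose_mul, ht,
      Matrix.transpose_transpose]
    simp only [Matrix.mul_assoc]
  rw [h1, h2]
  simp only [Matrix.sub_mul _ _ (P₁ - P₂), Matrix.mul_sub M (P₁ - P₂), Matrix.mul_assoc]

/-- A Schur complement bound: if `H X Hᵀ ≤ ε I`, then `X Hᵀ I⁻¹ H X ≤ ε X`. -/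
theorem conj_le_smul_of_le {l k : ℕ} {X : Matrix (Fin l) (Fin l) ℝ} {H : Matrix (Fin k) (Fin l) ℝ}
    {I : Matrix (Fin k) (Fin k) ℝ} (hX : X.PosSemidef) (hI : I.PosDef) {ε : ℝ} (hε : 0 < ε)
    (h : H * X * Hᵀ ≤ ε • I) : (X * Hᵀ * I⁻¹) * I * (X * Hᵀ * I⁻¹)ᵀ ≤ ε • X := by
  have hu : IsUnit I.det := (Matrix.isUnit_iff_isUnit_det _).mp hI.isUnit
  have hs := transpose_eq_of_posSemidef hI.posSemidef
  have hX' := transpose_eq_of_posSemidef hX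
  set Z := X * Hᵀ * I⁻¹ with hZ
  have hZI : Z * I = X * Hᵀ := by
    rw [hZ, Matrix.mul_assoc, Matrix.nonsing_inv_mul _ hu, Matrix.mul_one]
  have hIZ : I * Zᵀ = H * X := by
    have := congrArg Matrix.transpose hZI
    simpa only [Matrix.transpose_mul, hs, hX', Matrix.transpose_transpose] using this
  -- Multiplied by `ε`, this square falls short of `ε X - Z I Zᵀ` by `ε⁻¹ Z (ε I - H X Hᵀ) Zᵀ`,
  -- which is nonnegative by hypothesis.
  have h1 := conj_posSemidef hX (1 - ε⁻¹ • (Z * H))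
  have h2 : (1 - ε⁻¹ • (Z * H)) * X * (1 - ε⁻¹ • (Z * H))ᵀ =
      X - (2 * ε⁻¹) • (Z * I * Zᵀ) + (ε⁻¹ ^ 2) • (Z * (H * X * Hᵀ) * Zᵀ) := by
    calc (1 - ε⁻¹ • (Z * H)) * X * (1 - ε⁻¹ • (Z * H))ᵀ
        = X - ε⁻¹ • (Z * (H * X)) - ε⁻¹ • ((X * Hᵀ) * Zᵀ)
          + (ε⁻¹ ^ 2) • (Z * (H * X * Hᵀ) * Zᵀ) := by
          simp only [Matrix.transpose_sub, Matrix.transpose_one, Matrix.transpose_smul,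
            Matrix.transpose_mul, Matrix.mul_sub, Matrix.sub_mul, Matrix.mul_one, Matrix.one_mul,
            Matrix.smul_mul, Matrix.mul_smul, Matrix.mul_assoc, smul_sub, smul_smul, pow_two]
          abel
      _ = _ := by
          rw [← hIZ, ← hZI, two_mul, add_smul]
          simp only [Matrix.mul_assoc]
          abel
  have h3 := conj_le_conj h Z
  rw [Matrix.le_iff] at h3 ⊢
  have h4 : ε • X - Z * I * Zᵀ = ε • ((1 - ε⁻¹ • (Z * H)) * X * (1 - ε⁻¹ • (Z * H))ᵀ) +
      ε⁻¹ • (Z * (ε • I) * Zᵀ - Z * (H * X * Hᵀ) * Zᵀ) := by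
    rw [h2]
    simp only [smul_add, smul_sub, smul_smul, Matrix.mul_smul, Matrix.smul_mul]
    have e1 : ε * (2 * ε⁻¹) = 1 + 1 := by field_simp; norm_num
    have e2 : ε * ε⁻¹ ^ 2 = ε⁻¹ := by field_simp
    have e3 : ε⁻¹ * ε = 1 := by field_simp
    rw [e1, e2, e3, add_smul, one_smul]
    abel
  rw [h4]
  exact (h1.smul hε.le).add (h3.smul (inv_pos.mpr hε).le)

end RiccatiMap

/-! ### Monotone limits of matrices, and the iterates started at zero. -/

section Convergence

variable {n p r : ℕ}

theorem quadratic_le {X Y : Matrix (Fin n) (Fin n) ℝ} (h : X ≤ Y) (x : Fin n → ℝ) :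
    x ⬝ᵥ X *ᵥ x ≤ x ⬝ᵥ Y *ᵥ x := by
  have := (Matrix.le_iff.mp h).dotProduct_mulVec_nonneg x
  rw [star_trivial, Matrix.sub_mulVec, dotProduct_sub] at this
  linarith

/-- Symmetric matrices converge as soon as their quadratic forms do. -/
theorem tendsto_of_quadratic {X : ℕ → Matrix (Fin n) (Fin n) ℝ} (hX : ∀ k, (X k)ᵀ = X k)
    {l : (Fin n → ℝ) → ℝ} (h : ∀ x, Tendsto (fun k => x ⬝ᵥ X k *ᵥ x) atTop (𝓝 (l x))) :
    Tendsto X atTop (𝓝 (Matrix.of fun i j =>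
      (l (Pi.single i 1 + Pi.single j 1) - l (Pi.single i 1) - l (Pi.single j 1)) / 2)) := by
  refine tendsto_pi_nhds.mpr fun i => tendsto_pi_nhds.mpr fun j => ?_
  -- Polarization recovers each entry from three values of the quadratic form.
  have hij := ((h (Pi.single i 1 + Pi.single j 1)).sub (h (Pi.single i 1))).sub
    (h (Pi.single j 1)) |>.div_const 2
  refine hij.congr fun k => ?_
  have hs : X k j i = X k i j := congrFun (congrFun (hX k) i) j
  simp only [Matrix.mulVec_add, add_dotProduct, dotProduct_add, Matrix.mulVec_single_one,
    single_one_dotProduct, Matrix.col_apply]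
  rw [hs]
  ring

theorem tendsto_quadratic {X : ℕ → Matrix (Fin n) (Fin n) ℝ} {P : Matrix (Fin n) (Fin n) ℝ}
    (h : Tendsto X atTop (𝓝 P)) (x : Fin n → ℝ) :
    Tendsto (fun k => x ⬝ᵥ X k *ᵥ x) atTop (𝓝 (x ⬝ᵥ P *ᵥ x)) := by
  have hc : Continuous fun Y : Matrix (Fin n) (Fin n) ℝ => x ⬝ᵥ Y *ᵥ x := by fun_prop
  exact (hc.tendsto P).comp h

theorem posSemidef_of_tendsto {X : ℕ → Matrix (Fin n) (Fin n) ℝ} {P : Matrix (Fin n) (Fin n) ℝ}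
    (h : Tendsto X atTop (𝓝 P)) (hX : ∀ k, (X k).PosSemidef) : P.PosSemidef := by
  refine Matrix.PosSemidef.of_dotProduct_mulVec_nonneg ?_ fun x => ?_
  · rw [Matrix.IsHermitian, Matrix.conjTranspose_eq_transpose_of_trivial]
    have hc : Continuous fun Y : Matrix (Fin n) (Fin n) ℝ => Yᵀ := by fun_prop
    refine tendsto_nhds_unique ((hc.tendsto P).comp h) (h.congr fun k => ?_)
    exact (transpose_eq_of_posSemidef (hX k)).symm
  · rw [star_trivial]
    refine ge_of_tendsto' (tendsto_quadratic h x) fun k => ?_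
    simpa using (hX k).dotProduct_mulVec_nonneg x

theorem tendsto_of_squeeze {X Y Z : ℕ → Matrix (Fin n) (Fin n) ℝ} {P : Matrix (Fin n) (Fin n) ℝ}
    (hYs : ∀ k, (Y k)ᵀ = Y k) (hP : Pᵀ = P) (hX : Tendsto X atTop (𝓝 P))
    (hZ : Tendsto Z atTop (𝓝 P)) (hXY : ∀ k, X k ≤ Y k) (hYZ : ∀ k, Y k ≤ Z k) :
    Tendsto Y atTop (𝓝 P) := by
  have h1 := tendsto_of_quadratic hYs (l := fun x => x ⬝ᵥ P *ᵥ x) fun x =>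
    tendsto_of_tendsto_of_tendsto_of_le_of_le (tendsto_quadratic hX x) (tendsto_quadratic hZ x)
      (fun k => quadratic_le (hXY k) x) (fun k => quadratic_le (hYZ k) x)
  have h2 := tendsto_of_quadratic (X := fun _ => P) (fun _ => hP) (l := fun x => x ⬝ᵥ P *ᵥ x)
    fun x => tendsto_const_nhds
  rwa [← tendsto_nhds_unique tendsto_const_nhds h2] at h1

/-- An increasing sequence of symmetric matrices below a convergent sequence converges. -/
theorem exists_tendsto_of_monotone {X Z : ℕ → Matrix (Fin n) (Fin n) ℝ}
    {P : Matrix (Fin n) (Fin n) ℝ} (hXs : ∀ k, (X k)ᵀ = X k) (hX : Monotone X)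
    (hXZ : ∀ k, X k ≤ Z k) (hZ : Tendsto Z atTop (𝓝 P)) : ∃ Y, Tendsto X atTop (𝓝 Y) := by
  have h : ∀ x : Fin n → ℝ, ∃ l, Tendsto (fun k => x ⬝ᵥ X k *ᵥ x) atTop (𝓝 l) := by
    intro x
    obtain ⟨b, hb⟩ := (tendsto_quadratic hZ x).bddAbove_range
    refine ⟨_, tendsto_atTop_ciSup (fun i j hij => quadratic_le (hX hij) x) ⟨b, ?_⟩⟩
    rintro _ ⟨k, rfl⟩
    exact (quadratic_le (hXZ k) x).trans (hb ⟨k, rfl⟩)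
  choose l hl using h
  exact ⟨_, tendsto_of_quadratic hXs hl⟩

/-- The error covariances of the filter with noise factors `B` and `D`. -/
noncomputable def covSeq (A : Matrix (Fin n) (Fin n) ℝ) (B : Matrix (Fin n) (Fin r) ℝ)
    (C : Matrix (Fin p) (Fin n) ℝ) (D : Matrix (Fin p) (Fin r) ℝ)
    (P₀ : Matrix (Fin n) (Fin n) ℝ) : ℕ → Matrix (Fin n) (Fin n) ℝ :=
  errorCov A C (B * Bᵀ) (B * Dᵀ) (D * Dᵀ) P₀

variable {A : Matrix (Fin n) (Fin n) ℝ} {B : Matrix (Fin n) (Fin r) ℝ}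
  {C : Matrix (Fin p) (Fin n) ℝ} {D : Matrix (Fin p) (Fin r) ℝ} {P P₀ P₁ : Matrix (Fin n) (Fin n) ℝ}

theorem covSeq_zero : covSeq A B C D P₀ 0 = P₀ := rfl

theorem covSeq_succ (k : ℕ) :
    covSeq A B C D P₀ (k + 1) = riccati A B C D (covSeq A B C D P₀ k) := rfl

theorem covSeq_posSemidef (hR : (D * Dᵀ).PosDef) (h₀ : P₀.PosSemidef) (k : ℕ) :
    (covSeq A B C D P₀ k).PosSemidef := by
  induction k with
  | zero => exact h₀
  | succ k ih => exact riccati_posSemidef hR ih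

theorem covSeq_mono (hR : (D * Dᵀ).PosDef) (h₀ : P₀.PosSemidef) (h₁ : P₁.PosSemidef)
    (h : P₀ ≤ P₁) (k : ℕ) : covSeq A B C D P₀ k ≤ covSeq A B C D P₁ k := by
  induction k with
  | zero => exact h
  | succ k ih =>
    exact riccati_mono hR (covSeq_posSemidef hR h₀ k) (covSeq_posSemidef hR h₁ k) ih

theorem covSeq_zero_monotone (hR : (D * Dᵀ).PosDef) : Monotone (covSeq A B C D 0) := by
  refine monotone_nat_of_le_succ fun k => ?_
  induction k with
  | zero =>
    exact Matrix.nonneg_iff_posSemidef.mpr (covSeq_posSemidef hR Matrix.PosSemidef.zero 1)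
  | succ k ih =>
    exact riccati_mono hR (covSeq_posSemidef hR Matrix.PosSemidef.zero k)
      (covSeq_posSemidef hR Matrix.PosSemidef.zero (k + 1)) ih

theorem covSeq_of_fixed (h : riccati A B C D P = P) (k : ℕ) : covSeq A B C D P k = P := by
  induction k with
  | zero => rfl
  | succ k ih => rw [covSeq_succ, ih, h]

theorem continuousAt_optGain (hR : (D * Dᵀ).PosDef) (hP : P.PosSemidef) :
    ContinuousAt (optGain A B C D) P := by
  have hc : ContinuousAt (fun X => (optInnovation C D X)⁻¹) P := by
    have hu := (optInnovation_posDef (C := C) hR hP).isUnit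
    have h1 := NormedRing.inverse_continuousAt hu.unit
    rw [IsUnit.unit_spec] at h1
    have h2 : ContinuousAt (optInnovation C D) P := by
      unfold optInnovation innovationCov
      fun_prop
    simp only [Matrix.nonsing_inv_eq_ringInverse]
    exact ContinuousAt.comp (f := optInnovation C D) h1 h2
  change ContinuousAt (fun X => (A * X * Cᵀ + B * Dᵀ) * (optInnovation C D X)⁻¹) P
  fun_prop

theorem continuousAt_riccati (hR : (D * Dᵀ).PosDef) (hP : P.PosSemidef) :
    ContinuousAt (riccati A B C D) P := by
  have h1 := continuousAt_optGain (A := A) (B := B) (C := C) hR hP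
  have h2 : ContinuousAt (optInnovation C D) P := by
    unfold optInnovation innovationCov
    fun_prop
  unfold riccati
  fun_prop

/-- A limit of error covariances is a positive semidefinite fixed point. -/
theorem fixed_of_tendsto (hR : (D * Dᵀ).PosDef) (h₀ : P₀.PosSemidef)
    (h : Tendsto (covSeq A B C D P₀) atTop (𝓝 P)) : P.PosSemidef ∧ riccati A B C D P = P := by
  have hP := posSemidef_of_tendsto h (covSeq_posSemidef hR h₀)
  refine ⟨hP, tendsto_nhds_unique ((continuousAt_riccati hR hP).tendsto.comp h) ?_⟩
  exact h.comp (tendsto_add_atTop_nat 1)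

/-- Under detectability, the error covariances started at zero converge. -/
theorem exists_tendsto_covSeq_zero (hR : (D * Dᵀ).PosDef) (hdet : IsDetectable A C) :
    ∃ P, Tendsto (covSeq A B C D 0) atTop (𝓝 P) := by
  obtain ⟨L, hL⟩ := hdet
  obtain ⟨c, ρ, hc, hρ0, hρ1, hb⟩ := hL.exists_norm_pow_le
  set M := A - L * C with hM
  set N := (B - L * D) * (B - L * D)ᵀ with hN
  have hsum : Summable fun j : ℕ => M ^ j * N * (M ^ j)ᵀ := by
    refine Summable.of_norm_bounded (g := fun j => c ^ 2 * ‖N‖ * (ρ ^ 2) ^ j) ?_ fun j => ?_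
    · exact (summable_geometric_of_lt_one (by positivity) (by nlinarith)).mul_left _
    · calc ‖M ^ j * N * (M ^ j)ᵀ‖ ≤ ‖M ^ j‖ * ‖N‖ * ‖(M ^ j)ᵀ‖ :=
            (norm_mul_le _ _).trans (by gcongr; exact norm_mul_le _ _)
        _ ≤ (c * ρ ^ j) * ‖N‖ * (c * ρ ^ j) := by
            rw [l2_opNorm_transpose]
            gcongr <;> exact hb j
        _ = _ := by ring
  -- The right side is the covariance, from zero, of the suboptimal filter with constant gain `L`.
  have hle : ∀ k, covSeq A B C D 0 k ≤ ∑ j ∈ Finset.range k, M ^ j * N * (M ^ j)ᵀ := by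
    intro k
    induction k with
    | zero => simp [covSeq_zero]
    | succ k ih =>
      have h1 := (riccati_le_josephStep (A := A) (B := B) (C := C) hR
        (covSeq_posSemidef hR Matrix.PosSemidef.zero k) L).trans (josephStep_mono ih L)
      rw [covSeq_succ]
      refine h1.trans (le_of_eq ?_)
      rw [Finset.sum_range_succ', josephStep, Matrix.mul_sum, Matrix.sum_mul]
      congr 1
      · refine Finset.sum_congr rfl fun j _ => ?_
        rw [pow_succ' M]
        simp only [Matrix.transpose_mul, Matrix.mul_assoc, ← hM]
      · simp [hN]
  exact exists_tendsto_of_monotone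
    (fun k => transpose_eq_of_posSemidef (covSeq_posSemidef hR Matrix.PosSemidef.zero k))
    (covSeq_zero_monotone hR) hle hsum.hasSum.tendsto_sum_nat

end Convergence

/-! ### Stabilizing fixed points, exponential convergence and stabilizability. -/

section Equivalence

variable {n p r : ℕ} {A : Matrix (Fin n) (Fin n) ℝ} {B : Matrix (Fin n) (Fin r) ℝ}
  {C : Matrix (Fin p) (Fin n) ℝ} {D : Matrix (Fin p) (Fin r) ℝ}
  {P P₀ P₁ P₂ : Matrix (Fin n) (Fin n) ℝ}

theorem trace_conj_nonneg {k l : ℕ} {X : Matrix (Fin k) (Fin k) ℝ} (hX : X.PosSemidef)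
    (V : Matrix (Fin k) (Fin l) ℝ) : 0 ≤ (Vᵀ * X * V).trace := by
  simpa using (conj_posSemidef hX Vᵀ).trace_nonneg

/-- A fixed point of the Riccati map is stabilizing if its closed loop is stabilizable. -/
theorem isSchurStable_of_fixed (hR : (D * Dᵀ).PosDef) (hP : P.PosSemidef)
    (hfix : riccati A B C D P = P)
    (hst : IsStabilizable (A - optGain A B C D P * C) (B - optGain A B C D P * D)) :
    IsSchurStable (A - optGain A B C D P * C) := by
  by_contra hns
  obtain ⟨V, Λ, μ, hV0, hμ, hV, hΛ⟩ := exists_mode_of_not_isSchurStable hns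
  obtain ⟨G, hG⟩ := hst
  rw [riccati_eq_josephStep hR hP, josephStep] at hfix
  set M := A - optGain A B C D P * C
  set N := B - optGain A B C D P * D
  -- As `μ ≥ 1` and all terms are nonnegative, the noise term vanishes. The mode is then untouched
  -- by any feedback through `N`.
  have h1 : (Vᵀ * P * V).trace = μ * (Vᵀ * P * V).trace + ((Nᵀ * V)ᵀ * (Nᵀ * V)).trace := by
    conv_lhs => rw [← hfix]
    rw [Matrix.mul_add, Matrix.add_mul, Matrix.trace_add, trace_conj_of_mode hV hΛ]
    simp only [Matrix.transpose_mul, Matrix.transpose_transpose, Matrix.mul_assoc]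
  have h2 := trace_conj_nonneg hP V
  have hNV : Nᵀ * V = 0 := by
    by_contra h
    have h3 := trace_transpose_mul_self_pos h
    nlinarith
  refine not_isSchurStable_of_mode hV0 hμ ?_ hΛ hG
  rw [Matrix.transpose_sub, Matrix.transpose_mul, Matrix.sub_mul, Matrix.mul_assoc, hNV,
    Matrix.mul_zero, sub_zero, hV]

/-- There is at most one stabilizing fixed point of the Riccati map. -/
theorem eq_of_fixed (hR : (D * Dᵀ).PosDef) (hP₁ : P₁.PosSemidef) (hP₂ : P₂.PosSemidef)
    (h₁ : riccati A B C D P₁ = P₁) (h₂ : riccati A B C D P₂ = P₂)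
    (hs₁ : IsSchurStable (A - optGain A B C D P₁ * C))
    (hs₂ : IsSchurStable (A - optGain A B C D P₂ * C)) : P₁ = P₂ := by
  have h := riccati_sub (A := A) (B := B) (C := C) hR hP₁ hP₂
  rw [h₁, h₂] at h
  set M₁ := A - optGain A B C D P₁ * C
  set M₂ := A - optGain A B C D P₂ * C
  -- Iterating the difference formula between two fixed points; both powers tend to zero.
  have hk : ∀ k : ℕ, P₁ - P₂ = M₁ ^ k * (P₁ - P₂) * (M₂ ^ k)ᵀ := by
    intro k
    induction k with
    | zero => simp
    | succ k ih =>
      calc P₁ - P₂ = M₁ ^ k * (P₁ - P₂) * (M₂ ^ k)ᵀ := ih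
        _ = M₁ ^ k * (M₁ * (P₁ - P₂) * M₂ᵀ) * (M₂ ^ k)ᵀ := by rw [← h]
        _ = _ := by
            rw [pow_succ, pow_succ, Matrix.transpose_mul]; simp only [Matrix.mul_assoc]
  have hc : Continuous fun q : Matrix (Fin n) (Fin n) ℝ × Matrix (Fin n) (Fin n) ℝ =>
      q.1 * (P₁ - P₂) * q.2ᵀ := by fun_prop
  have ht := (hc.tendsto (0, 0)).comp (hs₁.tendsto_pow.prodMk_nhds hs₂.tendsto_pow)
  have hz : P₁ - P₂ = (0 : Matrix (Fin n) (Fin n) ℝ) * (P₁ - P₂) * 0ᵀ :=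
    tendsto_nhds_unique (tendsto_const_nhds (f := atTop (α := ℕ))) (ht.congr fun k => (hk k).symm)
  rw [Matrix.zero_mul, Matrix.zero_mul] at hz
  exact sub_eq_zero.mp hz

/-- Convergence to a stabilizing fixed point is exponentially fast. -/
theorem convergesExponentially_of_tendsto (hR : (D * Dᵀ).PosDef) (h₀ : P₀.PosSemidef)
    (hs : IsSchurStable (A - optGain A B C D P * C))
    (ht : Tendsto (covSeq A B C D P₀) atTop (𝓝 P)) :
    ConvergesExponentially (covSeq A B C D P₀) P := by
  obtain ⟨hP, hfix⟩ := fixed_of_tendsto hR h₀ ht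
  set M := A - optGain A B C D P * C with hM
  -- The exact recursion has the closed loop at the current iterate on the left. Its distance to `M`
  -- tends to zero by continuity of the gain.
  refine hs.exists_geometric_bound_conj (fun k => covSeq A B C D P₀ k - P)
    (fun k => ‖optGain A B C D P - optGain A B C D (covSeq A B C D P₀ k)‖ * ‖C‖ * ‖M‖) ?_ ?_
  · have h1 := (continuousAt_optGain (A := A) (B := B) (C := C) hR hP).tendsto.comp ht
    have h2 := ((((h1.const_sub (optGain A B C D P)).norm).mul_const ‖C‖).mul_const ‖M‖)
    simpa using h2
  · intro k
    have h1 := riccati_sub (A := A) (B := B) (C := C) hR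
      (covSeq_posSemidef (A := A) (B := B) (C := C) hR h₀ k) hP
    rw [hfix, ← covSeq_succ] at h1
    set e := covSeq A B C D P₀ k - P
    have h2 : covSeq A B C D P₀ (k + 1) - P - M * e * Mᵀ =
        (optGain A B C D P - optGain A B C D (covSeq A B C D P₀ k)) * C * e * Mᵀ := by
      rw [h1, ← hM, ← Matrix.sub_mul, ← Matrix.sub_mul]
      congr 2
      rw [hM, Matrix.sub_mul]
      abel
    rw [h2]
    calc _ ≤ ‖optGain A B C D P - optGain A B C D (covSeq A B C D P₀ k)‖ * ‖C‖ * ‖e‖ * ‖Mᵀ‖ := by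
          refine (Matrix.l2_opNorm_mul _ _).trans ?_
          gcongr
          refine (Matrix.l2_opNorm_mul _ _).trans ?_
          gcongr
          exact Matrix.l2_opNorm_mul _ _
      _ = _ := by rw [l2_opNorm_transpose]; ring

/-- Under detectability and stabilizability, the error covariances converge to a stabilizing
fixed point, exponentially fast. -/
theorem exists_fixed_of_detectable (hR : (D * Dᵀ).PosDef) (hdet : IsDetectable A C)
    (hst : ∀ F : Matrix (Fin n) (Fin p) ℝ, IsStabilizable (A - F * C) (B - F * D)) :
    ∃ P : Matrix (Fin n) (Fin n) ℝ, P.PosSemidef ∧ riccati A B C D P = P ∧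
      IsSchurStable (A - optGain A B C D P * C) ∧
      (∀ P', P'.PosSemidef → riccati A B C D P' = P' → P' = P) ∧
      ∀ P₀, P₀.PosSemidef → ConvergesExponentially (covSeq A B C D P₀) P := by
  obtain ⟨P, ht⟩ := exists_tendsto_covSeq_zero (B := B) hR hdet
  obtain ⟨hP, hfix⟩ := fixed_of_tendsto hR Matrix.PosSemidef.zero ht
  have hs := isSchurStable_of_fixed hR hP hfix (hst _)
  refine ⟨P, hP, hfix, hs, fun P' hP' hfix' =>
    eq_of_fixed hR hP' hP hfix' hfix (isSchurStable_of_fixed hR hP' hfix' (hst _)) hs,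
    fun P₀ h₀ => convergesExponentially_of_tendsto hR h₀ hs ?_⟩
  set M := A - optGain A B C D P * C with hM
  -- The right side is the covariance from `P₀` under the constant gain at `P`.
  have hle : ∀ k, covSeq A B C D P₀ k ≤ P + M ^ k * (P₀ - P) * (M ^ k)ᵀ := by
    intro k
    induction k with
    | zero => simp [covSeq_zero]
    | succ k ih =>
      have h1 := (riccati_le_josephStep (A := A) (B := B) (C := C) hR
        (covSeq_posSemidef hR h₀ k) (optGain A B C D P)).trans (josephStep_mono ih _)
      rw [covSeq_succ]
      refine h1.trans (le_of_eq ?_)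
      have h2 := riccati_eq_josephStep (A := A) (B := B) (C := C) hR hP
      rw [hfix] at h2
      conv_rhs => arg 1; rw [h2]
      rw [josephStep, josephStep, ← hM, pow_succ']
      simp only [Matrix.mul_add, Matrix.add_mul, Matrix.transpose_mul, Matrix.mul_assoc]
      abel
  have hc : Continuous fun X : Matrix (Fin n) (Fin n) ℝ => P + X * (P₀ - P) * Xᵀ := by fun_prop
  have hup := (hc.tendsto 0).comp hs.tendsto_pow
  rw [Matrix.zero_mul, Matrix.zero_mul, add_zero] at hup
  exact tendsto_of_squeeze
    (fun k => transpose_eq_of_posSemidef (covSeq_posSemidef hR h₀ k))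
    (transpose_eq_of_posSemidef hP) ht hup
    (covSeq_mono hR Matrix.PosSemidef.zero h₀ (Matrix.nonneg_iff_posSemidef.mpr h₀)) hle

/-- The error covariances started at zero are reachable for the decorrelated system. -/
theorem covSeq_zero_isReachableIn (hR : (D * Dᵀ).PosDef) (k : ℕ) :
    IsReachableIn (A - optGain A B C D 0 * C) (B - optGain A B C D 0 * D) k
      (covSeq A B C D 0 k) := by
  induction k with
  | zero => rfl
  | succ k ih =>
    have hk := covSeq_posSemidef (A := A) (B := B) (C := C) hR Matrix.PosSemidef.zero k
    have h1 := riccati_sub (A := A) (B := B) (C := C) hR Matrix.PosSemidef.zero hk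
    have h2 := riccati_eq_josephStep (A := A) (B := B) (C := C) hR Matrix.PosSemidef.zero
    -- With `M₀`, `N₀` the decorrelated pair and `X` the current iterate, the next one is `N₀ N₀ᵀ +
    -- M₀ X M_Xᵀ`, where `M_X` is the closed loop at `X`.
    refine ⟨(B - optGain A B C D 0 * D)ᵀ, covSeq A B C D 0 k *
      (A - optGain A B C D (covSeq A B C D 0 k) * C)ᵀ, ih.mul_right _, ?_⟩
    rw [covSeq_succ, ← sub_sub_cancel (riccati A B C D 0) (riccati A B C D (covSeq A B C D 0 k)),
      h1, h2, josephStep]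
    simp only [zero_sub, Matrix.mul_neg, Matrix.neg_mul, Matrix.mul_zero, Matrix.zero_mul,
      zero_add, sub_neg_eq_add, Matrix.mul_assoc]

/-- Stabilizability of the decorrelated system implies stabilizability after every output
injection. -/
theorem isStabilizable_of_decorrelated (hR : (D * Dᵀ).PosDef)
    (h : IsStabilizable (A - optGain A B C D 0 * C) (B - optGain A B C D 0 * D))
    (F : Matrix (Fin n) (Fin p) ℝ) : IsStabilizable (A - F * C) (B - F * D) := by
  obtain ⟨G, hG⟩ := h
  have hu : IsUnit (D * Dᵀ).det := (Matrix.isUnit_iff_isUnit_det _).mp hR.isUnit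
  have h0 : (B - optGain A B C D 0 * D) * Dᵀ = 0 := by
    have := optGain_mul_optInnovation (A := A) (B := B) (C := C) hR Matrix.PosSemidef.zero
    simp only [optInnovation, innovationCov, Matrix.mul_zero, Matrix.zero_mul, zero_add] at this
    rw [Matrix.sub_mul, Matrix.mul_assoc, this, sub_self]
  set F₀ := optGain A B C D 0
  set J := (D * Dᵀ)⁻¹ with hJ
  -- Adding an element of the range of `Dᵀ` makes `D` times the feedback equal to `C`, so that `F`
  -- cancels. Since `(B - F₀ D) Dᵀ = 0`, what remains is the closed loop given by `G`.
  refine ⟨G + Dᵀ * (J * (C - D * G)), ?_⟩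
  convert hG using 1
  have hD : D * (Dᵀ * (J * (C - D * G))) = C - D * G := by
    rw [← Matrix.mul_assoc, ← Matrix.mul_assoc, hJ, Matrix.mul_nonsing_inv _ hu, Matrix.one_mul]
  have hB : B * (Dᵀ * (J * (C - D * G))) = F₀ * (C - D * G) := by
    have h1 : (B - F₀ * D) * (Dᵀ * (J * (C - D * G))) = 0 := by
      rw [← Matrix.mul_assoc, h0, Matrix.zero_mul]
    rw [Matrix.sub_mul, Matrix.mul_assoc, hD, sub_eq_zero] at h1
    exact h1
  rw [Matrix.mul_add, Matrix.sub_mul B _ (Dᵀ * _), hB, Matrix.mul_assoc F, hD]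
  simp only [Matrix.mul_sub, Matrix.sub_mul, Matrix.mul_assoc]
  abel

/-- If the error covariances started at zero converge to a stabilizing matrix, the system is
stabilizable after every output injection. -/
theorem isStabilizable_of_tendsto (hR : (D * Dᵀ).PosDef)
    (ht : Tendsto (covSeq A B C D 0) atTop (𝓝 P))
    (hs : IsSchurStable (A - optGain A B C D P * C)) (F : Matrix (Fin n) (Fin p) ℝ) :
    IsStabilizable (A - F * C) (B - F * D) := by
  obtain ⟨hP, -⟩ := fixed_of_tendsto hR Matrix.PosSemidef.zero ht
  refine isStabilizable_of_decorrelated hR ?_ F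
  have hg := (continuousAt_optGain (A := A) (B := B) (C := C) hR hP).tendsto.comp ht
  have hc : Continuous fun K : Matrix (Fin n) (Fin p) ℝ => A - K * C := by fun_prop
  obtain ⟨k, hk⟩ :=
    (((hc.tendsto _).comp hg).eventually hs.eventually_nhds).exists
  simp only [Function.comp] at hk
  have hX := covSeq_posSemidef (A := A) (B := B) (C := C) hR Matrix.PosSemidef.zero k
  have h1 := optGain_sub (A := A) (B := B) (C := C) hR hX Matrix.PosSemidef.zero
  have hr := covSeq_zero_isReachableIn (A := A) (B := B) (C := C) hR k
  set X := covSeq A B C D 0 k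
  rw [sub_zero] at h1
  -- The stable closed loop at `X` is the decorrelated matrix minus this `N`. The extra step comes
  -- from the leading factor of `N`, with zero input.
  refine isStabilizable_of_isReachableIn (k := k + 1)
    (N := (A - optGain A B C D 0 * C) * (X * (Cᵀ * (optInnovation C D X)⁻¹ * C)))
    ⟨0, _, hr.mul_right _, by rw [Matrix.mul_zero, zero_add]⟩ ?_
  convert hk using 1
  have h2 : (A - optGain A B C D 0 * C) * (X * (Cᵀ * (optInnovation C D X)⁻¹ * C)) =
      (optGain A B C D X - optGain A B C D 0) * C := by
    rw [h1]; simp only [Matrix.mul_assoc]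
  rw [h2, Matrix.sub_mul]
  abel

theorem le_norm_smul_one {k : ℕ} {X : Matrix (Fin k) (Fin k) ℝ} (hX : Xᵀ = X) {b : ℝ}
    (hb : ‖X‖ ≤ b) : X ≤ b • (1 : Matrix (Fin k) (Fin k) ℝ) := by
  rw [Matrix.le_iff]
  refine Matrix.PosSemidef.of_dotProduct_mulVec_nonneg ?_ fun x => ?_
  · rw [Matrix.IsHermitian, Matrix.conjTranspose_eq_transpose_of_trivial]
    simp [hX]
  · have h1 := Matrix.l2_opNorm_mulVec X (WithLp.toLp 2 x)
    have h2 := real_inner_le_norm (WithLp.toLp 2 (X *ᵥ x)) (WithLp.toLp 2 x)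
    have h3 : ‖WithLp.toLp 2 x‖ ^ 2 = x ⬝ᵥ x := by
      rw [← real_inner_self_eq_norm_sq, EuclideanSpace.inner_toLp_toLp, star_trivial]
    rw [EuclideanSpace.inner_toLp_toLp, star_trivial] at h2
    have h4 : ‖WithLp.toLp 2 (X *ᵥ x)‖ ≤ ‖X‖ * ‖WithLp.toLp 2 x‖ := h1
    have h5 : x ⬝ᵥ X *ᵥ x ≤ b * (x ⬝ᵥ x) := by
      rw [← h3]
      calc x ⬝ᵥ X *ᵥ x ≤ ‖WithLp.toLp 2 (X *ᵥ x)‖ * ‖WithLp.toLp 2 x‖ := h2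
        _ ≤ (b * ‖WithLp.toLp 2 x‖) * ‖WithLp.toLp 2 x‖ := by
            gcongr
            exact h4.trans (by gcongr)
        _ = _ := by ring
    rw [star_trivial, Matrix.sub_mulVec, dotProduct_sub, Matrix.smul_mulVec, Matrix.one_mulVec,
      dotProduct_smul, smul_eq_mul]
    linarith

/-- The bound `I⁻¹ ≤ κ` inverts to `1 ≤ κ I`: `conj_le_smul_of_le` is applied with `X = I`, `H =
I⁻¹` and the identity as weight. -/
theorem exists_one_le_smul {k : ℕ} {I : Matrix (Fin k) (Fin k) ℝ} (hI : I.PosDef) :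
    ∃ κ : ℝ, 0 < κ ∧ 1 ≤ κ • I := by
  have hu : IsUnit I.det := (Matrix.isUnit_iff_isUnit_det _).mp hI.isUnit
  have hs := transpose_eq_of_posSemidef hI.posSemidef
  have hs' := transpose_eq_of_posSemidef hI.inv.posSemidef
  have h0 : 0 < ‖I⁻¹‖ + 1 := by positivity
  refine ⟨‖I⁻¹‖ + 1, h0, ?_⟩
  have h := conj_le_smul_of_le (X := I) (H := I⁻¹) (I := 1) hI.posSemidef Matrix.PosDef.one h0
    (by
      rw [Matrix.nonsing_inv_mul _ hu, Matrix.one_mul, hs']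
      exact le_norm_smul_one hs' (by linarith))
  simpa [hs', Matrix.mul_nonsing_inv _ hu] using h

/-- One step of the Riccati map contracts a perturbation of a fixed point by at most the factor
`(1 + ε)⁻¹` along an unstable mode of the closed loop. -/
theorem trace_mode_step (hR : (D * Dᵀ).PosDef) (hP : P.PosSemidef) (hfix : riccati A B C D P = P)
    {V : Matrix (Fin n) (Fin 2) ℝ} {Λ : Matrix (Fin 2) (Fin 2) ℝ} {μ : ℝ} (hμ : 1 ≤ μ)
    (hV : (A - optGain A B C D P * C)ᵀ * V = V * Λ) (hΛ : Λ * Λᵀ = μ • 1)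
    {X : Matrix (Fin n) (Fin n) ℝ} (hX : X.PosSemidef) (hPX : P ≤ X) {ε : ℝ} (hε : 0 < ε)
    (h : C * (X - P) * Cᵀ ≤ ε • optInnovation C D P) :
    (Vᵀ * (X - P) * V).trace ≤
      (1 + ε) * (Vᵀ * (riccati A B C D X - P) * V).trace := by
  have hΔ : (X - P).PosSemidef := Matrix.le_iff.mp hPX
  have hIX := optInnovation_posDef (C := C) hR hX
  have hI : optInnovation C D X = C * (X - P) * Cᵀ + optInnovation C D P := by
    simp only [optInnovation, innovationCov, Matrix.mul_sub, Matrix.sub_mul]; abel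
  -- The innovation at `X` is the one at `P` plus the left side, which turns `ε` into `ε / (1 + ε)`.
  -- The correction thus removes at most this fraction of `X - P`, leaving at least `(1 + ε)⁻¹`.
  have h1 : C * (X - P) * Cᵀ ≤ (ε / (1 + ε)) • optInnovation C D X := by
    rw [Matrix.le_iff] at h ⊢
    have : (ε / (1 + ε)) • optInnovation C D X - C * (X - P) * Cᵀ =
        (1 / (1 + ε)) • (ε • optInnovation C D P - C * (X - P) * Cᵀ) := by
      rw [hI, smul_sub, smul_smul, smul_add, one_div_mul_eq_div]
      have e : ε / (1 + ε) = 1 - 1 / (1 + ε) := by field_simp; ring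
      nth_rewrite 1 [e]
      rw [sub_smul, one_smul]
      abel
    rw [this]
    exact h.smul (by positivity)
  have h2 := conj_le_smul_of_le hΔ hIX (by positivity) h1
  have h3 := riccati_sub' (A := A) (B := B) (C := C) hR hX hP
  rw [hfix] at h3
  set Y := (X - P) * Cᵀ * (optInnovation C D X)⁻¹ * optInnovation C D X *
    ((X - P) * Cᵀ * (optInnovation C D X)⁻¹)ᵀ
  rw [h3, trace_conj_of_mode hV hΛ]
  have h4 := trace_conj_nonneg (Matrix.le_iff.mp h2) V
  have h5 := trace_conj_nonneg hΔ V
  simp only [Matrix.mul_sub Vᵀ, Matrix.sub_mul _ _ V, Matrix.trace_sub, Matrix.mul_smul,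
    Matrix.smul_mul, Matrix.trace_smul, smul_eq_mul] at h4 h5 ⊢
  set a := (Vᵀ * X * V).trace - (Vᵀ * P * V).trace
  set y := (Vᵀ * Y * V).trace
  have h6 : (1 + ε) * y ≤ ε * a := by
    have : (1 + ε) * (ε / (1 + ε) * a) = ε * a := by field_simp
    rw [← this]
    gcongr
    linarith
  have h7 : 0 ≤ a - y := by nlinarith
  have h8 : (1 + ε) * (a - y) ≤ (1 + ε) * (μ * (a - y)) := by
    gcongr
    nlinarith
  linarith

/-- A fixed point to which the error covariances started above it converge exponentially fast is
stabilizing. -/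
theorem isSchurStable_of_convergesExponentially (hR : (D * Dᵀ).PosDef) (hP : P.PosSemidef)
    (hfix : riccati A B C D P = P) (h : ConvergesExponentially (covSeq A B C D (P + 1)) P) :
    IsSchurStable (A - optGain A B C D P * C) := by
  by_contra hns
  obtain ⟨V, Λ, μ, hV0, hμ, hV, hΛ⟩ := exists_mode_of_not_isSchurStable hns
  obtain ⟨c, ρ, hc, hρ0, hρ1, hb⟩ := h
  obtain ⟨κ, hκ, hκI⟩ := exists_one_le_smul (optInnovation_posDef (C := C) hR hP)
  -- Starting at `P + 1` makes the initial error the identity, which is positive along every mode.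
  have hP1 : (P + 1).PosSemidef := hP.add Matrix.PosSemidef.one
  set X := covSeq A B C D (P + 1) with hX
  have hXps : ∀ k, (X k).PosSemidef := covSeq_posSemidef hR hP1
  have hPX : ∀ k, P ≤ X k := fun k => by
    have := covSeq_mono (A := A) (B := B) (C := C) hR hP hP1
      (by rw [Matrix.le_iff, add_sub_cancel_left]; exact Matrix.PosSemidef.one) k
    rwa [covSeq_of_fixed hfix] at this
  -- The term `(1 / 2) ^ k` only makes `β` strictly positive, as `trace_mode_step` requires, without
  -- spoiling summability.
  set β : ℕ → ℝ := fun k => ‖C‖ * (c * ρ ^ k) * ‖C‖ + (1 / 2) ^ k with hβ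
  have hβ0 : ∀ k, 0 < β k := fun k => by positivity
  have hbound : ∀ k, C * (X k - P) * Cᵀ ≤ (β k * κ) • optInnovation C D P := by
    intro k
    have hps := conj_posSemidef (Matrix.le_iff.mp (hPX k)) C
    have h1 : ‖C * (X k - P) * Cᵀ‖ ≤ β k := by
      calc ‖C * (X k - P) * Cᵀ‖ ≤ ‖C‖ * ‖X k - P‖ * ‖Cᵀ‖ := by
            refine (Matrix.l2_opNorm_mul _ _).trans ?_
            gcongr
            exact Matrix.l2_opNorm_mul _ _
        _ ≤ ‖C‖ * (c * ρ ^ k) * ‖C‖ := by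
            rw [l2_opNorm_transpose]
            gcongr
            exact hb k
        _ ≤ β k := by simp only [hβ]; linarith [show (0 : ℝ) < (1 / 2) ^ k by positivity]
    refine (le_norm_smul_one (transpose_eq_of_posSemidef hps) h1).trans ?_
    rw [mul_smul, Matrix.le_iff, ← smul_sub]
    exact (Matrix.le_iff.mp hκI).smul (hβ0 k).le
  set d : ℕ → ℝ := fun k => (Vᵀ * (X k - P) * V).trace with hd
  have hstep : ∀ k, d k ≤ (1 + β k * κ) * d (k + 1) := fun k =>
    trace_mode_step hR hP hfix hμ hV hΛ (hXps k) (hPX k) (mul_pos (hβ0 k) hκ) (hbound k)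
  have hd_nonneg : ∀ k, 0 ≤ d k := fun k => trace_conj_nonneg (Matrix.le_iff.mp (hPX k)) V
  have hd0 : 0 < d 0 := by
    simpa [hd, hX, covSeq_zero] using trace_transpose_mul_self_pos hV0
  have hsum : Summable fun k => β k * κ := by
    refine Summable.mul_right κ (Summable.add ?_ ?_)
    · exact ((summable_geometric_of_lt_one hρ0 hρ1).mul_left c |>.mul_left ‖C‖).mul_right ‖C‖
    · exact summable_geometric_of_lt_one (by norm_num) (by norm_num)
  have hprod : ∀ k, d 0 ≤ Real.exp (∑ j ∈ Finset.range k, β j * κ) * d k := by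
    intro k
    induction k with
    | zero => simp
    | succ k ih =>
      refine ih.trans ?_
      rw [Finset.sum_range_succ, Real.exp_add, mul_assoc]
      gcongr
      refine (hstep k).trans ?_
      gcongr
      · exact hd_nonneg _
      · linarith [Real.add_one_le_exp (β k * κ)]
  -- Summability bounds the product of all factors `1 + β j * κ`, so `d k` stays away from zero
  -- although `X k` tends to `P`.
  have hlow : ∀ k, d 0 ≤ Real.exp (∑' j, β j * κ) * d k := fun k => by
    refine (hprod k).trans ?_
    gcongr
    · exact hd_nonneg _
    · exact hsum.sum_le_tsum _ fun j _ => (mul_pos (hβ0 j) hκ).le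
  have hX0 : Tendsto (fun k => X k - P) atTop (𝓝 0) := by
    refine squeeze_zero_norm hb ?_
    simpa using (tendsto_pow_atTop_nhds_zero_of_lt_one hρ0 hρ1).const_mul c
  have hcont : Continuous fun Y : Matrix (Fin n) (Fin n) ℝ =>
      Real.exp (∑' j, β j * κ) * (Vᵀ * Y * V).trace := by fun_prop
  have := ge_of_tendsto' ((hcont.tendsto 0).comp hX0) hlow
  simp at this
  linarith

end Equivalence

/-! ### Passage to the Riccati equation and the equivalences. -/

section Main

variable {n p r : ℕ} {A : Matrix (Fin n) (Fin n) ℝ} {B : Matrix (Fin n) (Fin r) ℝ}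
  {C : Matrix (Fin p) (Fin n) ℝ} {D : Matrix (Fin p) (Fin r) ℝ} {P : Matrix (Fin n) (Fin n) ℝ}

theorem solvesDARE_iff (hR : (D * Dᵀ).PosDef) (hP : P.PosSemidef) :
    SolvesDARE A C (B * Bᵀ) (B * Dᵀ) (D * Dᵀ) P ↔ riccati A B C D P = P := by
  have hs := transpose_eq_of_posSemidef (optInnovation_posDef (C := C) hR hP).posSemidef
  have h : riccati A B C D P = A * P * Aᵀ + B * Bᵀ - (A * P * Cᵀ + B * Dᵀ) *
      (optInnovation C D P)⁻¹ * (A * P * Cᵀ + B * Dᵀ)ᵀ := by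
    have ht : (optGain A B C D P)ᵀ = (optInnovation C D P)⁻¹ * (A * P * Cᵀ + B * Dᵀ)ᵀ := by
      change ((A * P * Cᵀ + B * Dᵀ) * (optInnovation C D P)⁻¹)ᵀ = _
      rw [Matrix.transpose_mul, Matrix.transpose_nonsing_inv, hs]
    rw [riccati, optGain_mul_optInnovation hR hP, ht, Matrix.mul_assoc _ (optInnovation C D P)⁻¹]
  rw [h]
  exact eq_comm

theorem ConvergesExponentially.tendsto {X : ℕ → Matrix (Fin n) (Fin n) ℝ}
    (h : ConvergesExponentially X P) : Tendsto X atTop (𝓝 P) := by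
  obtain ⟨c, ρ, -, hρ0, hρ1, hb⟩ := h
  rw [tendsto_iff_norm_sub_tendsto_zero]
  refine squeeze_zero (fun _ => norm_nonneg _) hb ?_
  simpa using (tendsto_pow_atTop_nhds_zero_of_lt_one hρ0 hρ1).const_mul c

/-- Detectability and stabilizability give the unique stabilizing solution together with
exponential convergence to it. -/
theorem exists_solution_of_detectable (hR : (D * Dᵀ).PosDef) (hdet : IsDetectable A C)
    (hst : ∀ F : Matrix (Fin n) (Fin p) ℝ, IsStabilizable (A - F * C) (B - F * D)) :
    ∃ P, IsUniqueStabilizingSolution A C (B * Bᵀ) (B * Dᵀ) (D * Dᵀ) P ∧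
      ErrorCovConvergesTo A C (B * Bᵀ) (B * Dᵀ) (D * Dᵀ) P := by
  obtain ⟨P, hP, hfix, hs, huniq, hconv⟩ := exists_fixed_of_detectable hR hdet hst
  exact ⟨P, ⟨hP, (solvesDARE_iff hR hP).mpr hfix, hs, fun P' hP' h' =>
    huniq P' hP' ((solvesDARE_iff hR hP').mp h')⟩, hconv⟩

/-- The stabilizing gain itself detects, so the iterates from zero converge to a positive
semidefinite solution, which uniqueness identifies with `P`. -/
theorem IsUniqueStabilizingSolution.detectable_and_stabilizable (hR : (D * Dᵀ).PosDef)
    (h : IsUniqueStabilizingSolution A C (B * Bᵀ) (B * Dᵀ) (D * Dᵀ) P) :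
    IsDetectable A C ∧
      ∀ F : Matrix (Fin n) (Fin p) ℝ, IsStabilizable (A - F * C) (B - F * D) := by
  obtain ⟨hP, -, hs, huniq⟩ := h
  have hdet : IsDetectable A C := ⟨_, hs⟩
  obtain ⟨P', ht⟩ := exists_tendsto_covSeq_zero (B := B) hR hdet
  obtain ⟨hP', hfix'⟩ := fixed_of_tendsto hR Matrix.PosSemidef.zero ht
  rw [huniq P' hP' ((solvesDARE_iff hR hP').mpr hfix')] at ht
  exact ⟨hdet, isStabilizable_of_tendsto hR ht hs⟩

/-- Two initial values suffice: zero makes `P` a fixed point and a limit of reachable iterates, and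
`P + 1` makes it stabilizing. -/
theorem ErrorCovConvergesTo.detectable_and_stabilizable (hR : (D * Dᵀ).PosDef)
    (h : ErrorCovConvergesTo A C (B * Bᵀ) (B * Dᵀ) (D * Dᵀ) P) :
    IsDetectable A C ∧
      ∀ F : Matrix (Fin n) (Fin p) ℝ, IsStabilizable (A - F * C) (B - F * D) := by
  have ht : Tendsto (covSeq A B C D 0) atTop (𝓝 P) := (h 0 Matrix.PosSemidef.zero).tendsto
  obtain ⟨hP, hfix⟩ := fixed_of_tendsto hR Matrix.PosSemidef.zero ht
  have hs := isSchurStable_of_convergesExponentially hR hP hfix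
    (h (P + 1) (hP.add Matrix.PosSemidef.one))
  exact ⟨⟨_, hs⟩, isStabilizable_of_tendsto hR ht hs⟩

end Main

end KalmanFilter

theorem mainTheorem7 {n p r : ℕ}
    (A : Matrix (Fin n) (Fin n) ℝ) (C : Matrix (Fin p) (Fin n) ℝ)
    (Q : Matrix (Fin n) (Fin n) ℝ) (S : Matrix (Fin n) (Fin p) ℝ)
    (R : Matrix (Fin p) (Fin p) ℝ) (hR : R.PosDef)
    (B : Matrix (Fin n) (Fin r) ℝ) (D : Matrix (Fin p) (Fin r) ℝ)
    (hfact : Matrix.fromBlocks Q S S.transpose R =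
      Matrix.fromRows B D * (Matrix.fromRows B D).transpose)
    (hrank : (Matrix.fromRows B D).rank = r) :
    [ ∃ P, KalmanFilter.IsUniqueStabilizingSolution A C Q S R P,
      ∃ P, KalmanFilter.ErrorCovConvergesTo A C Q S R P,
      KalmanFilter.IsDetectable A C ∧
        ∀ F : Matrix (Fin n) (Fin p) ℝ,
          KalmanFilter.IsStabilizable (A - F * C) (B - F * D) ].TFAE ∧
    ∀ P, KalmanFilter.IsUniqueStabilizingSolution A C Q S R P →
      KalmanFilter.ErrorCovConvergesTo A C Q S R P := by
  rw [Matrix.transpose_fromRows, Matrix.fromRows_mul_fromCols, Matrix.fromBlocks_inj] at hfact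
  obtain ⟨rfl, rfl, -, rfl⟩ := hfact
  refine ⟨?_, fun P hP => ?_⟩
  · tfae_have 1 → 3 := fun ⟨_, h⟩ => h.detectable_and_stabilizable hR
    tfae_have 2 → 3 := fun ⟨_, h⟩ => h.detectable_and_stabilizable hR
    tfae_have 3 → 1 := fun ⟨h₁, h₂⟩ =>
      (KalmanFilter.exists_solution_of_detectable hR h₁ h₂).imp fun _ h => h.1
    tfae_have 3 → 2 := fun ⟨h₁, h₂⟩ =>
      (KalmanFilter.exists_solution_of_detectable hR h₁ h₂).imp fun _ h => h.2
    tfae_finish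
  · obtain ⟨h₁, h₂⟩ := hP.detectable_and_stabilizable hR
    obtain ⟨P', hP', hconv⟩ := KalmanFilter.exists_solution_of_detectable hR h₁ h₂
    -- Uniqueness identifies the limit constructed from (iii) with the given solution.
    rwa [hP.2.2.2 P' hP'.1 hP'.2.1] at hconv
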